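/- **Lemma (A posteriori proximity bound).** Setting. Let $T>0$ and consider the Bolza problem of minimizing $K(x(0),x(T))+\int_0^T L(t,x,u)\,dt$ subject to $\dot x=f(t,x,u)$ on $[0,T]$ and $b(x(0),x(T))=0\in\mathbb R^{k}$ (with $k\ge 0$), where $f,L$ are $C^2$ on $[0,T]\times\mathbb R^n\times\mathbb R^m$ and $K,b$ are $C^2$ on $\mathbb R^n\times\mathbb R^n$. Put $H=L+p^\top f$. For $z=(x,u,p,\lambda)\in W^{1,2}([0,T];\mathbb R^n)\times L^2([0,T];\mathbb R^m)\times W^{1,2}([0,T];\mathbb R^n)\times\mathbb R^k$ let $$F_1=\dot x-f,\quad F_2=-\dot p-H_x,\quad F_3=H_u,\quad F_4=b(x(0),x(T)),$$ $$F_5=p(T)-K_{x_T}-b_{x_T}^\top\lambda,\qquad F_6=-p(0)-K_{x_0}-b_{x_0}^\top\lambda ;$$ $z$ is a KKT point if $F(z)=0$ (a.e. in the first three components). Values $F(z)$ are measured by $\|r\|=\|r_1\|_{L^2}+\|r_2\|_{L^2}+\|r_3\|_{L^2}+|r_4|+|r_5|+|r_6|$, and variations by $$\|(\xi,v,\pi,\mu)\|^2=|\!|\!|\xi|\!|\!|^2+\|v\|_{L^2}^2+|\!|\!|\pi|\!|\!|^2+|\mu|^2,\qquad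 |\!|\!|\xi|\!|\!|^2=\|\xi\|_{L^2}^2+\|\dot\xi\|_{L^2}^2+|\xi(0)|^2+|\xi(T)|^2 .$$ Let $z_N=(X^N,u^N,p^N,\lambda^N)$ (the reconstruction) be a point of this space with $u^N$ essentially bounded. *Strong regularity* at $z_N$ means that the solution map $r\mapsto d$ of the linearized system $DF(z_N)d=r$ has a single-valued Lipschitz localization around $(0,0)$; then $DF(z_N)$ is boundedly invertible, and $C_{\rm geo}:=\|DF(z_N)^{-1}\|$ in the above norms. The *strengthened Legendre condition* with $\rho>0$ is $H_{uu}(t,X^N,u^N,p^N)\succeq\rho I$ for a.e. $t\in[0,T]$. Let $$E_\infty=\|F_1(z_N)\|_{L^\infty}+\|F_2(z_N)\|_{L^\infty}+\|F_3(z_N)\|_{L^\infty}+|F_4(z_N)|+|F_5(z_N)|+|F_6(z_N)|,$$ $$\mathcal R(z;z_N)=\|x-X^N\|_{0,\infty}+\|u-u^N\|_{0,\infty}+\|p-p^N\|_{0,\infty},$$ where $\|\cdot\|_{0,\infty}$ is the supremum norm on $[0,T]$ (essential supremum for controls). Given a number $c_0$, put $$C_{xp,\infty}=c_0\,C_{\rm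 geo}(1+T)\exp\bigl((\|A\|_{L^\infty}+\|B\|_{L^\infty})T\bigr),\qquad C_{u,\infty}=\rho^{-1}(\|H_{ux}\|_\infty+\|H_{up}\|_\infty)C_{xp,\infty}+\rho^{-1},$$ $C_{\rm close,\infty}=C_{xp,\infty}+C_{u,\infty}$, where $A=f_x$, $B=f_u$, and $A,B,H_{ux},H_{up}$ are evaluated along $z_N$. Claim. There is an absolute constant $c_0>0$ such that, for every such problem, every $\rho>0$ and all $M,G$, there are $\varepsilon,\delta>0$ with the following property. Let $z_N$ satisfy the strengthened Legendre condition with $\rho$ and strong regularity, let $X^N,u^N,p^N,\lambda^N$ be bounded by $M$ and $C_{\rm geo}\le G$. If $E_\infty\le\varepsilon$, then $C_{\rm close,\infty}E_\infty\le\delta$, and there is an exact KKT point $z^\star=(x^\star,u^\star,p^\star,\lambda^\star)$ with $$\mathcal R(z^\star;z_N)\le C_{\rm close,\infty}\,E_\infty ,$$ and $z^\star$ is the only KKT point $z$ with $\mathcal R(z;z_N)\le\delta$ (so in particular the only one satisfying the bound). -/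

import Mathlib

open MeasureTheory Set
open scoped ENNReal

noncomputable section

namespace Bolza

/-- Euclidean space of dimension `d`. -/
abbrev E (d : ℕ) : Type := EuclideanSpace ℝ (Fin d)

/-- Lebesgue measure on the time interval `[0, T]`. -/
abbrev timeMeasure (T : ℝ) : Measure ℝ := volume.restrict (Icc 0 T)

/-- The space `L²([0, T]; ℝᵈ)` (classes modulo almost everywhere equality). -/
abbrev L2 (T : ℝ) (d : ℕ) : Type := Lp (E d) 2 (timeMeasure T)

/-- The space `W^{1,2}([0, T]; ℝᵈ)`: an element is given by its initial value `a.1 = x(0)` and its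
weak derivative `a.2 = ẋ ∈ L²`, which determine, and are determined by, the (absolutely) continuous
function `x(t) = x(0) + ∫₀ᵗ ẋ`; see `Arc.val`. -/
abbrev Arc (T : ℝ) (d : ℕ) : Type := E d × L2 T d

/-- The value `x(t)`, for `t ∈ [0, T]`, of an element of `W^{1,2}([0, T]; ℝᵈ)`. -/
def Arc.val {T : ℝ} {d : ℕ} (a : Arc T d) (t : ℝ) : E d := a.1 + ∫ s in (0 : ℝ)..t, a.2 s

/-- The squared norm `‖x‖²_{L²} + ‖ẋ‖²_{L²} + |x(0)|² + |x(T)|²` on `W^{1,2}`. -/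
def Arc.normSq {T : ℝ} {d : ℕ} (a : Arc T d) : ℝ :=
  (∫ t, ‖Arc.val a t‖ ^ 2 ∂(timeMeasure T)) + ‖a.2‖ ^ 2 + ‖a.1‖ ^ 2 + ‖Arc.val a T‖ ^ 2

/-- The uniform norm on `[0, T]` (no junk value: it lives in `[0, ∞]`). -/
def supNorm (T : ℝ) {d : ℕ} (g : ℝ → E d) : ℝ≥0∞ := ⨆ t ∈ Icc (0 : ℝ) T, ‖g t‖ₑ

/-- Primal-dual variables `z = (x, u, p, lam)` in
`W^{1,2}([0,T]; ℝⁿ) × L²([0,T]; ℝᵐ) × W^{1,2}([0,T]; ℝⁿ) × ℝᵏ`. -/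
abbrev PD (T : ℝ) (n m k : ℕ) : Type := Arc T n × L2 T m × Arc T n × E k

namespace PD
variable {T : ℝ} {n m k : ℕ}

/-- The state as an element of `W^{1,2}`. -/
def xArc (z : PD T n m k) : Arc T n := z.1

/-- The control. -/
def u (z : PD T n m k) : L2 T m := z.2.1

/-- The costate as an element of `W^{1,2}`. -/
def pArc (z : PD T n m k) : Arc T n := z.2.2.1

/-- The multiplier of the boundary constraints. -/
def lam (z : PD T n m k) : E k := z.2.2.2

/-- State trajectory. -/
def x (z : PD T n m k) (t : ℝ) : E n := z.xArc.val t

/-- Costate trajectory. -/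
def p (z : PD T n m k) (t : ℝ) : E n := z.pArc.val t

/-- Time derivative of the state. -/
def xdot (z : PD T n m k) : L2 T n := z.xArc.2

/-- Time derivative of the costate. -/
def pdot (z : PD T n m k) : L2 T n := z.pArc.2

/-- The product Hilbert norm of a primal-dual variation. -/
def nrm (d : PD T n m k) : ℝ :=
  Real.sqrt (d.xArc.normSq + ‖d.u‖ ^ 2 + d.pArc.normSq + ‖d.lam‖ ^ 2)

/-- `‖x - X‖_{0,∞} + ‖u - U‖_{0,∞} + ‖p - P‖_{0,∞}`; the norm of the control, which is an
almost-everywhere class, is the essential supremum. -/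
def supDist (z w : PD T n m k) : ℝ≥0∞ :=
  supNorm T (fun t => z.x t - w.x t)
    + eLpNorm (fun t => z.u t - w.u t) ∞ (timeMeasure T)
    + supNorm T (fun t => z.p t - w.p t)

/-- `x`, `u`, `p` and `lam` are bounded by `M`. -/
def BoundedBy (z : PD T n m k) (M : ℝ) : Prop :=
  (∀ t ∈ Icc (0 : ℝ) T, ‖z.x t‖ ≤ M) ∧ (∀ᵐ t ∂(timeMeasure T), ‖z.u t‖ ≤ M) ∧
    (∀ t ∈ Icc (0 : ℝ) T, ‖z.p t‖ ≤ M) ∧ ‖z.lam‖ ≤ M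

end PD

/-- The codomain `L² × L² × L² × ℝᵏ × ℝⁿ × ℝⁿ` of the KKT mapping. -/
abbrev Res (T : ℝ) (n m k : ℕ) : Type := L2 T n × L2 T n × L2 T m × E k × E n × E n

/-- The mixed norm on the codomain of the KKT mapping (sum of the `L²` and Euclidean norms). -/
def Res.nrm {T : ℝ} {n m k : ℕ} (r : Res T n m k) : ℝ :=
  ‖r.1‖ + ‖r.2.1‖ + ‖r.2.2.1‖ + ‖r.2.2.2.1‖ + ‖r.2.2.2.2.1‖ + ‖r.2.2.2.2.2‖

end Bolza

open Bolza

/-- Data of the Bolza problem: minimize `K (x 0) (x T) + ∫₀ᵀ L t x u` subject to `ẋ = f t x u`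
and `b (x 0) (x T) = 0`, with `n` states, `m` controls and `k` boundary constraints. -/
structure BolzaProblem (n m k : ℕ) where
  f : ℝ → E n → E m → E n
  L : ℝ → E n → E m → ℝ
  K : E n → E n → ℝ
  b : E n → E n → E k

namespace BolzaProblem

variable {T : ℝ} {n m k : ℕ} (P : BolzaProblem n m k)

/-- The data are of class `C²`: `f`, `L` on `[0, T] × ℝⁿ × ℝᵐ` and `K`, `b` on `ℝⁿ × ℝⁿ`. -/
structure IsC2 (T : ℝ) : Prop where
  f : ContDiffOn ℝ 2 (fun q : ℝ × E n × E m => P.f q.1 q.2.1 q.2.2) (Icc 0 T ×ˢ univ)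
  L : ContDiffOn ℝ 2 (fun q : ℝ × E n × E m => P.L q.1 q.2.1 q.2.2) (Icc 0 T ×ˢ univ)
  K : ContDiff ℝ 2 (fun q : E n × E n => P.K q.1 q.2)
  b : ContDiff ℝ 2 (fun q : E n × E n => P.b q.1 q.2)

/-- The Hamiltonian `H = L + pᵀ f`. -/
def H (t : ℝ) (x : E n) (u : E m) (p : E n) : ℝ := P.L t x u + inner ℝ p (P.f t x u)

/-- The gradient `H_x`. -/
def Hx (t : ℝ) (x : E n) (u : E m) (p : E n) : E n := gradient (fun y => P.H t y u p) x

/-- The gradient `H_u`. -/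
def Hu (t : ℝ) (x : E n) (u : E m) (p : E n) : E m := gradient (fun v => P.H t x v p) u

/-- The second derivative `H_uu`. -/
def Huu (t : ℝ) (x : E n) (u : E m) (p : E n) : E m →L[ℝ] E m :=
  fderiv ℝ (fun v => P.Hu t x v p) u

/-- The second derivative `H_ux`. -/
def Hux (t : ℝ) (x : E n) (u : E m) (p : E n) : E n →L[ℝ] E m :=
  fderiv ℝ (fun y => P.Hu t y u p) x

/-- The second derivative `H_up`. -/
def Hup (t : ℝ) (x : E n) (u : E m) (p : E n) : E n →L[ℝ] E m :=
  fderiv ℝ (fun q => P.Hu t x u q) p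

/-- The transversality residual at time `T`: `p_T - K_{x_T} - b_{x_T}ᵀ lam`. -/
def bcT (x0 xT pT : E n) (lam : E k) : E n :=
  pT - gradient (fun y => P.K x0 y) xT
    - ContinuousLinearMap.adjoint (fderiv ℝ (fun y => P.b x0 y) xT) lam

/-- The transversality residual at time `0`: `-p_0 - K_{x_0} - b_{x_0}ᵀ lam`. -/
def bc0 (x0 xT p0 : E n) (lam : E k) : E n :=
  -p0 - gradient (fun y => P.K y xT) x0
    - ContinuousLinearMap.adjoint (fderiv ℝ (fun y => P.b y xT) x0) lam

/-- The components `F₁, …, F₆` of the KKT mapping: dynamics, adjoint equation, stationarity,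
boundary constraints, transversality at `T` and at `0`. -/
def F1 (z : PD T n m k) (t : ℝ) : E n := z.xdot t - P.f t (z.x t) (z.u t)

def F2 (z : PD T n m k) (t : ℝ) : E n := -z.pdot t - P.Hx t (z.x t) (z.u t) (z.p t)

def F3 (z : PD T n m k) (t : ℝ) : E m := P.Hu t (z.x t) (z.u t) (z.p t)

def F4 (z : PD T n m k) : E k := P.b (z.x 0) (z.x T)

def F5 (z : PD T n m k) : E n := P.bcT (z.x 0) (z.x T) (z.p T) z.lam

def F6 (z : PD T n m k) : E n := P.bc0 (z.x 0) (z.x T) (z.p 0) z.lam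

/-- `z` is an exact KKT point: `F z = 0`. -/
def IsKKT (z : PD T n m k) : Prop :=
  (∀ᵐ t ∂(timeMeasure T), P.F1 z t = 0) ∧ (∀ᵐ t ∂(timeMeasure T), P.F2 z t = 0) ∧
    (∀ᵐ t ∂(timeMeasure T), P.F3 z t = 0) ∧ P.F4 z = 0 ∧ P.F5 z = 0 ∧ P.F6 z = 0

/-- The `L^∞` KKT residual `E_∞ = e_dyn + e_adj + e_stat + e_bc`. -/
def Einf (z : PD T n m k) : ℝ≥0∞ :=
  eLpNorm (P.F1 z) ∞ (timeMeasure T) + eLpNorm (P.F2 z) ∞ (timeMeasure T)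
    + eLpNorm (P.F3 z) ∞ (timeMeasure T) + (‖P.F4 z‖ₑ + ‖P.F5 z‖ₑ + ‖P.F6 z‖ₑ)

/-- The linearized KKT system `DF(z) d = r`, i.e. the KKT mapping is differentiated at `z` in the
direction `d`. -/
def LinKKT (z d : PD T n m k) (r : Res T n m k) : Prop :=
  (∀ᵐ t ∂(timeMeasure T),
    d.xdot t - fderiv ℝ (fun q : E n × E m => P.f t q.1 q.2) (z.x t, z.u t) (d.x t, d.u t)
      = r.1 t) ∧
  (∀ᵐ t ∂(timeMeasure T),
    -d.pdot t - fderiv ℝ (fun q : E n × E m × E n => P.Hx t q.1 q.2.1 q.2.2)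
      (z.x t, z.u t, z.p t) (d.x t, d.u t, d.p t) = r.2.1 t) ∧
  (∀ᵐ t ∂(timeMeasure T),
    fderiv ℝ (fun q : E n × E m × E n => P.Hu t q.1 q.2.1 q.2.2)
      (z.x t, z.u t, z.p t) (d.x t, d.u t, d.p t) = r.2.2.1 t) ∧
  fderiv ℝ (fun q : E n × E n => P.b q.1 q.2) (z.x 0, z.x T) (d.x 0, d.x T) = r.2.2.2.1 ∧
  fderiv ℝ (fun q : E n × E n × E n × E k => P.bcT q.1 q.2.1 q.2.2.1 q.2.2.2)
    (z.x 0, z.x T, z.p T, z.lam) (d.x 0, d.x T, d.p T, d.lam) = r.2.2.2.2.1 ∧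
  fderiv ℝ (fun q : E n × E n × E n × E k => P.bc0 q.1 q.2.1 q.2.2.1 q.2.2.2)
    (z.x 0, z.x T, z.p 0, z.lam) (d.x 0, d.x T, d.p 0, d.lam) = r.2.2.2.2.2

/-- Strong regularity at `z` in the sense of Robinson (there are no inequality constraints, so the
generalized equation is an equation): the solution map `r ↦ d` of the linearized KKT system
`DF(z) d = r` has a single-valued Lipschitz localization around `(0, 0)`. -/
def StronglyRegular (z : PD T n m k) : Prop :=
  ∃ κ a c : ℝ, 0 ≤ κ ∧ 0 < a ∧ 0 < c ∧
    (∀ r : Res T n m k, r.nrm ≤ c → ∃! d : PD T n m k, d.nrm ≤ a ∧ P.LinKKT z d r) ∧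
    (∀ (r r' : Res T n m k) (d d' : PD T n m k), r.nrm ≤ c → r'.nrm ≤ c →
      d.nrm ≤ a → d'.nrm ≤ a → P.LinKKT z d r → P.LinKKT z d' r' →
      (d - d').nrm ≤ κ * (r - r').nrm)

/-- `C_geo = ‖DF(z)⁻¹‖`, the operator norm of the inverse of the linearized KKT map (used only where
strong regularity makes `DF(z)` boundedly invertible). -/
def Cgeo (z : PD T n m k) : ℝ :=
  sInf {C : ℝ | 0 ≤ C ∧ ∀ (d : PD T n m k) (r : Res T n m k), P.LinKKT z d r →
    d.nrm ≤ C * r.nrm}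

/-- The strengthened Legendre condition along `z`: `H_uu ⪰ ρ I` almost everywhere. -/
def StrengthenedLegendre (ρ : ℝ) (z : PD T n m k) : Prop :=
  ∀ᵐ t ∂(timeMeasure T), ∀ v : E m,
    ρ * ‖v‖ ^ 2 ≤ inner ℝ (P.Huu t (z.x t) (z.u t) (z.p t) v) v

/-- `‖A‖_{L^∞}`, where `A(t) = f_x` along `z`. -/
def normA (z : PD T n m k) : ℝ :=
  (eLpNorm (fun t => fderiv ℝ (fun y => P.f t y (z.u t)) (z.x t)) ∞ (timeMeasure T)).toReal

/-- `‖B‖_{L^∞}`, where `B(t) = f_u` along `z`. -/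
def normB (z : PD T n m k) : ℝ :=
  (eLpNorm (fun t => fderiv ℝ (fun v => P.f t (z.x t) v) (z.u t)) ∞ (timeMeasure T)).toReal

/-- `‖H_ux‖_∞` along `z`. -/
def normHux (z : PD T n m k) : ℝ :=
  (eLpNorm (fun t => P.Hux t (z.x t) (z.u t) (z.p t)) ∞ (timeMeasure T)).toReal

/-- `‖H_up‖_∞` along `z`. -/
def normHup (z : PD T n m k) : ℝ :=
  (eLpNorm (fun t => P.Hup t (z.x t) (z.u t) (z.p t)) ∞ (timeMeasure T)).toReal

/-- `C_{xp,∞} = c₀ C_geo (1 + T) exp((‖A‖ + ‖B‖) T)`. -/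
def Cxp (c₀ : ℝ) (z : PD T n m k) : ℝ :=
  c₀ * P.Cgeo z * (1 + T) * Real.exp ((P.normA z + P.normB z) * T)

/-- `C_{u,∞} = ρ⁻¹ (‖H_ux‖ + ‖H_up‖) C_{xp,∞} + ρ⁻¹`. -/
def Cu (c₀ ρ : ℝ) (z : PD T n m k) : ℝ :=
  ρ⁻¹ * (P.normHux z + P.normHup z) * P.Cxp c₀ z + ρ⁻¹

/-- `C_{close,∞} = C_{xp,∞} + C_{u,∞}`. -/
def Cclose (c₀ ρ : ℝ) (z : PD T n m k) : ℝ := P.Cxp c₀ z + P.Cu c₀ ρ z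

end BolzaProblem

end

/-!
The KKT system is solved near the reconstruction `zN` by the simplified Newton iteration
`F(z) + DF(zN)(w - z) = 0`. Along a trajectory the KKT mapping is the linear operator `(ẋ, -ṗ, 0)` minus
superposition with the `C¹` map `(f, H_x, -H_u)`, completed by a `C¹` map of the boundary values
and the multiplier.

The difficulty is that superposition is not differentiable on `L²`, whereas strong regularity
bounds `DF(zN)⁻¹` in `L²` norms only. Both sides are reconciled by using two topologies. On a
uniform ball around `zN` the linearization error of the superposition is, pointwise in time, at
most `η` times the increment, where `η` is small with the radius of the ball
(`exists_uniform_strict_deriv`, `exists_linearApprox`). Integrating this bound shows that the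
Newton map contracts the *Hilbert* distance (`LinearApprox.norm_step_sub_le`), and uniform balls
are closed, hence complete, for that distance (`PD.isClosed_supBall`). The Newton map sends a
suitable uniform ball to itself (`LinearApprox.mapsTo_supBall`): the state and the costate are
bounded uniformly through the embedding of `W^{1,2}` into continuous functions
(`Arc.norm_val_le`), with a factor `1 + √T`, and the control is then recovered pointwise from the
stationarity equation, whose second derivative `H_uu` is bounded below by `ρ`
(`StrengthenedLegendre.norm_u_le`). The radius `2κE_∞` of the ball is proportional to the
residual, so the fixed point satisfies `x`- and `p`-bounds with twice the linear constant; since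
`(1 + √T)² ≤ 2(1 + T)`, the value `c₀ = 32` leaves a definite share of `C_{xp,∞} E_∞` unused. The
nonlinear part of the bound for the control is absorbed in that share, because `C_geo` is bounded
below whenever there are controls (`StronglyRegular.norm_le_Cgeo_mul`).

For uniqueness, the multiplier is not part of the distance in which KKT points are compared. The
boundary conditions are affine in it, and strong regularity makes their linear part injective with
a bound given by `C_geo`, so the multiplier of a KKT point close to `zN` is close to that of `zN`
(`LinearApprox.norm_lam_sub_le`); the contraction estimate then identifies it with the fixed
point.
-/

/-! ### Calculus with a time parameter -/

namespace Bolza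

section Calculus

variable {V W : Type*} [NormedAddCommGroup V] [NormedSpace ℝ V]
  [NormedAddCommGroup W] [NormedSpace ℝ W] {T : ℝ}

theorem hasFDerivAt_slice {g : ℝ × V → W}
    (hg : ContDiffOn ℝ 1 g (Icc 0 T ×ˢ univ)) {t : ℝ} (ht : t ∈ Icc 0 T) (q : V) :
    HasFDerivAt (fun q => g (t, q))
      ((fderivWithin ℝ g (Icc 0 T ×ˢ univ) (t, q)).comp (ContinuousLinearMap.inr ℝ ℝ V)) q := by
  have h1 : HasFDerivWithinAt g (fderivWithin ℝ g (Icc 0 T ×ˢ univ) (t, q))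
      (Icc 0 T ×ˢ univ) (t, q) :=
    ((hg.differentiableOn one_ne_zero) (t, q) ⟨ht, mem_univ _⟩).hasFDerivWithinAt
  have h2 : HasFDerivWithinAt (fun q : V => (t, q)) (ContinuousLinearMap.inr ℝ ℝ V) univ q :=
    (hasFDerivAt_prodMk_right t q).hasFDerivWithinAt
  have h3 := HasFDerivWithinAt.comp q h1 h2 (fun q _ => ⟨ht, mem_univ _⟩)
  exact hasFDerivWithinAt_univ.1 h3

theorem differentiable_slice {g : ℝ × V → W}
    (hg : ContDiffOn ℝ 1 g (Icc 0 T ×ˢ univ)) {t : ℝ} (ht : t ∈ Icc 0 T) :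
    Differentiable ℝ (fun q => g (t, q)) :=
  fun q => (hasFDerivAt_slice hg ht q).differentiableAt

/-- Differentiating in the space variable only costs one order of joint smoothness. -/
theorem contDiffOn_fderiv_slice (hT : 0 < T) {g : ℝ × V → W} {j : ℕ}
    (hg : ContDiffOn ℝ (j + 1) g (Icc 0 T ×ˢ univ)) :
    ContDiffOn ℝ j (fun y : ℝ × V => fderiv ℝ (fun q => g (y.1, q)) y.2) (Icc 0 T ×ˢ univ) := by
  have hu : UniqueDiffOn ℝ (Icc 0 T ×ˢ (univ : Set V)) :=
    (uniqueDiffOn_Icc hT).prod uniqueDiffOn_univ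
  have h1 : ContDiffOn ℝ j (fderivWithin ℝ g (Icc 0 T ×ˢ univ)) (Icc 0 T ×ˢ univ) :=
    hg.fderivWithin hu le_rfl
  have hg1 : ContDiffOn ℝ 1 g (Icc 0 T ×ˢ univ) := hg.of_le (by simp)
  refine (h1.clm_comp (contDiffOn_const (c := ContinuousLinearMap.inr ℝ ℝ V))).congr ?_
  rintro ⟨t, q⟩ ⟨ht, -⟩
  exact (hasFDerivAt_slice hg1 ht q).fderiv

/-- Uniform strict differentiability, together with bounds, on a bounded set of base points: the
linearization at `q₀` approximates increments near `q₀` up to a factor `η`, and the radius of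
validity depends on the size of `q₀` only. -/
theorem exists_uniform_strict_deriv [FiniteDimensional ℝ V] (hT : 0 < T) {g : ℝ × V → W}
    (hg : ContDiffOn ℝ 1 g (Icc 0 T ×ˢ univ)) (R : ℝ) {η : ℝ} (hη : 0 < η) :
    ∃ δ > 0, ∀ t ∈ Icc 0 T, ∀ q₀ q : V, ‖q₀‖ ≤ R → ‖q - q₀‖ ≤ δ →
      ‖fderiv ℝ (fun q => g (t, q)) q - fderiv ℝ (fun q => g (t, q)) q₀‖ ≤ η ∧
      ∀ q' : V, ‖q' - q₀‖ ≤ δ →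
        ‖g (t, q) - g (t, q') - fderiv ℝ (fun q => g (t, q)) q₀ (q - q')‖ ≤ η * ‖q - q'‖ := by
  have hc : ContinuousOn (fun y : ℝ × V => fderiv ℝ (fun q => g (y.1, q)) y.2)
      (Icc 0 T ×ˢ univ) :=
    (contDiffOn_fderiv_slice (j := 0) hT (by simpa using hg)).continuousOn
  have hK : IsCompact (Icc 0 T ×ˢ Metric.closedBall (0 : V) (R + 1)) :=
    isCompact_Icc.prod (isCompact_closedBall _ _)
  have huc := hK.uniformContinuousOn_of_continuous
    (hc.mono (prod_mono_right (subset_univ _)))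
  obtain ⟨δ₀, hδ₀, h⟩ := Metric.uniformContinuousOn_iff.1 huc η hη
  have key : ∀ t ∈ Icc 0 T, ∀ q₀ q : V, ‖q₀‖ ≤ R → ‖q - q₀‖ ≤ min (δ₀ / 2) 1 →
      ‖fderiv ℝ (fun q => g (t, q)) q - fderiv ℝ (fun q => g (t, q)) q₀‖ ≤ η := by
    intro t ht q₀ q hq₀ hq
    have h1 : ‖q - q₀‖ ≤ 1 := hq.trans (min_le_right _ _)
    have h2 : ‖q - q₀‖ ≤ δ₀ / 2 := hq.trans (min_le_left _ _)
    have := h (t, q) ⟨ht, by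
        rw [mem_closedBall_zero_iff]
        have := norm_add_le (q - q₀) q₀
        rw [sub_add_cancel] at this
        linarith⟩ (t, q₀)
      ⟨ht, by rw [mem_closedBall_zero_iff]; linarith⟩
      (by rw [Prod.dist_eq, dist_self, dist_eq_norm]
          exact max_lt hδ₀ (by linarith))
    rw [dist_eq_norm] at this
    exact this.le
  refine ⟨min (δ₀ / 2) 1, by positivity, fun t ht q₀ q hq₀ hq =>
    ⟨key t ht q₀ q hq₀ hq, fun q' hq' => ?_⟩⟩
  refine (convex_closedBall q₀ (min (δ₀ / 2) 1)).norm_image_sub_le_of_norm_hasFDerivWithin_le'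
    (f := fun q => g (t, q)) (f' := fun q => fderiv ℝ (fun q => g (t, q)) q)
    (fun y _ => ((differentiable_slice hg ht) y).hasFDerivAt.hasFDerivWithinAt)
    (fun y hy => key t ht q₀ y hq₀ (by simpa [dist_eq_norm] using hy))
    (by simpa [dist_eq_norm] using hq') (by simpa [dist_eq_norm] using hq)

theorem exists_bound_fderiv_slice [FiniteDimensional ℝ V] (hT : 0 < T) {g : ℝ × V → W}
    (hg : ContDiffOn ℝ 1 g (Icc 0 T ×ˢ univ)) (R : ℝ) :
    ∃ C, ∀ t ∈ Icc 0 T, ∀ q : V, ‖q‖ ≤ R → ‖fderiv ℝ (fun q => g (t, q)) q‖ ≤ C := by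
  have hc : ContinuousOn (fun y : ℝ × V => fderiv ℝ (fun q => g (y.1, q)) y.2)
      (Icc 0 T ×ˢ univ) :=
    (contDiffOn_fderiv_slice (j := 0) hT (by simpa using hg)).continuousOn
  have hK : IsCompact (Icc 0 T ×ˢ Metric.closedBall (0 : V) R) :=
    isCompact_Icc.prod (isCompact_closedBall _ _)
  obtain ⟨C, hC⟩ := hK.exists_bound_of_continuousOn (hc.mono (prod_mono_right (subset_univ _)))
  exact ⟨C, fun t ht q hq => hC (t, q) ⟨ht, by simpa using hq⟩⟩

end Calculus

/-- Superposition of a function continuous on `[0, T] × V` with a measurable function. -/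
theorem aestronglyMeasurable_superposition
    {V W : Type*} [TopologicalSpace V]
    [TopologicalSpace W] {T : ℝ} (hT : 0 < T) {g : ℝ × V → W}
    (hg : ContinuousOn g (Icc 0 T ×ˢ univ)) {w : ℝ → V}
    (hw : AEStronglyMeasurable w (timeMeasure T)) :
    AEStronglyMeasurable (fun t => g (t, w t)) (timeMeasure T) := by
  have h1 : Continuous (fun y : ℝ × V => g (projIcc 0 T hT.le y.1, y.2)) :=
    hg.comp_continuous (by fun_prop) (fun y => ⟨(projIcc 0 T hT.le y.1).2, mem_univ _⟩)
  have h2 := h1.comp_aestronglyMeasurable (aestronglyMeasurable_id.prodMk hw)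
  refine h2.congr ?_
  filter_upwards [ae_restrict_mem measurableSet_Icc] with t ht
  simp [projIcc_of_mem hT.le ht]

theorem isBoundedLinearMap_toDual_symm (d : ℕ) :
    IsBoundedLinearMap ℝ (InnerProductSpace.toDual ℝ (E d)).symm where
  map_add := map_add _
  map_smul c x := by simp
  bound := ⟨1, one_pos, fun x => by simp⟩

theorem isBoundedLinearMap_adjoint (d k : ℕ) :
    IsBoundedLinearMap ℝ (fun A : E d →L[ℝ] E k => ContinuousLinearMap.adjoint A) where
  map_add := map_add _
  map_smul c x := by simp
  bound := ⟨1, one_pos, fun x => by simp⟩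

end Bolza

/-! ### The spaces `L²` and `W^{1,2}` on `[0, T]` -/

namespace Bolza

section SquareIntegrable

variable {T : ℝ} {d j : ℕ}

theorem timeMeasure_real_univ (hT : 0 < T) : (timeMeasure T).real univ = T := by
  simp [timeMeasure, measureReal_restrict_apply, Real.volume_real_Icc_of_le hT.le]

theorem norm_L2_le_of_bound {F : Type*} [NormedAddCommGroup F] (hT : 0 < T)
    (h : Lp F 2 (timeMeasure T)) {c : ℝ} (hc : 0 ≤ c)
    (hb : ∀ᵐ t ∂(timeMeasure T), ‖h t‖ ≤ c) : ‖h‖ ≤ Real.sqrt T * c := by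
  have h1 : ((measureUnivNNReal (timeMeasure T) : NNReal) : ℝ) = T := timeMeasure_real_univ hT
  simpa [h1, Real.sqrt_eq_rpow] using Lp.norm_le_of_ae_bound hc hb

/-- An affine pointwise bound integrates to the corresponding bound in `L²`. -/
theorem norm_L2_le_of_affine_bound (hT : 0 < T) (h : L2 T d) (w : L2 T j) {c η : ℝ} (hc : 0 ≤ c)
    (hη : 0 ≤ η) (hb : ∀ᵐ t ∂(timeMeasure T), ‖h t‖ ≤ c + η * ‖w t‖) :
    ‖h‖ ≤ Real.sqrt T * c + η * ‖w‖ := by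
  have hw : MemLp (fun t => ‖w t‖) 2 (timeMeasure T) := (Lp.memLp w).norm
  have hcm : MemLp (fun _ : ℝ => c) 2 (timeMeasure T) := memLp_const c
  have h1 : ‖h‖ ≤ ‖hcm.toLp _ + η • hw.toLp _‖ := by
    refine Lp.norm_le_norm_of_ae_le ?_
    filter_upwards [hb, Lp.coeFn_add (hcm.toLp _) (η • (hw.toLp _)), Lp.coeFn_smul η hw.toLp,
      hcm.coeFn_toLp, hw.coeFn_toLp] with t h1 h2 h3 h4 h5
    rw [h2, Pi.add_apply, h3, Pi.smul_apply, h4, h5, smul_eq_mul, Real.norm_eq_abs]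
    exact h1.trans (le_abs_self _)
  have h2 : ‖hcm.toLp _‖ ≤ Real.sqrt T * c := by
    refine norm_L2_le_of_bound hT _ hc ?_
    filter_upwards [hcm.coeFn_toLp] with t h4
    rw [h4, Real.norm_eq_abs, abs_of_nonneg hc]
  have h3 : ‖hw.toLp _‖ = ‖w‖ := by
    rw [Lp.norm_toLp, eLpNorm_norm, Lp.norm_def]
  calc ‖h‖ ≤ ‖hcm.toLp _‖ + ‖η • hw.toLp _‖ := h1.trans (norm_add_le _ _)
    _ ≤ _ := by
      rw [norm_smul, h3, Real.norm_eq_abs, abs_of_nonneg hη]; gcongr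

theorem integrableOn_L2 (v : L2 T d) : IntegrableOn v (Icc 0 T) :=
  (Lp.memLp v).integrable (by norm_num)

theorem integral_norm_L2_le (hT : 0 < T) (v : L2 T d) :
    ∫ t, ‖v t‖ ∂(timeMeasure T) ≤ Real.sqrt T * ‖v‖ := by
  have h1 := eLpNorm_le_eLpNorm_mul_rpow_measure_univ (p := 1) (q := 2) (μ := timeMeasure T)
    (f := v) (by norm_num) (Lp.aestronglyMeasurable v)
  rw [integral_norm_eq_lintegral_enorm (Lp.aestronglyMeasurable v),
    ← eLpNorm_one_eq_lintegral_enorm]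
  refine (ENNReal.toReal_mono ?_ h1).trans (le_of_eq ?_)
  · refine ENNReal.mul_ne_top (Lp.memLp v).2.ne (ENNReal.rpow_ne_top_of_nonneg (by norm_num) ?_)
    simp [timeMeasure]
  · rw [ENNReal.toReal_mul, ← Lp.norm_def, ← ENNReal.toReal_rpow, ← measureReal_def,
      timeMeasure_real_univ hT, mul_comm, Real.sqrt_eq_rpow]
    norm_num

/-- Essential balls are closed in `L²`. -/
theorem isClosed_essBall (w : L2 T d) (δ : ℝ) :
    IsClosed {v : L2 T d | ∀ᵐ t ∂(timeMeasure T), ‖v t - w t‖ ≤ δ} := by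
  refine IsSeqClosed.isClosed fun v v₀ hv hlim => ?_
  obtain ⟨φ, -, hφ⟩ := (tendstoInMeasure_of_tendsto_Lp hlim).exists_seq_tendsto_ae
  have : ∀ᵐ t ∂(timeMeasure T), ∀ i, ‖v (φ i) t - w t‖ ≤ δ := ae_all_iff.2 fun i => hv (φ i)
  filter_upwards [hφ, this] with t h1 h2
  exact le_of_tendsto (h1.sub_const _).norm (Filter.Eventually.of_forall h2)

end SquareIntegrable

section Arcs

variable {T : ℝ} {d : ℕ}

theorem ae_Ioc_of_ae_timeMeasure {t : ℝ} (ht : t ∈ Icc 0 T) {q : ℝ → Prop}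
    (h : ∀ᵐ s ∂(timeMeasure T), q s) : ∀ᵐ s, s ∈ Ioc 0 t → q s := by
  filter_upwards [(ae_restrict_iff' measurableSet_Icc).1 h] with s hs h1
  exact hs ⟨h1.1.le, h1.2.trans ht.2⟩

theorem intervalIntegrable_L2 (v : L2 T d) {t : ℝ} (ht : t ∈ Icc 0 T) :
    IntervalIntegrable v volume 0 t := by
  rw [intervalIntegrable_iff_integrableOn_Ioc_of_le ht.1]
  exact (integrableOn_L2 v).mono_set fun s hs => ⟨hs.1.le, hs.2.trans ht.2⟩

theorem Arc.val_sub (a b : Arc T d) {t : ℝ} (ht : t ∈ Icc 0 T) :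
    (a - b).val t = a.val t - b.val t := by
  have h : ∫ s in (0 : ℝ)..t, (a - b).2 s = ∫ s in (0 : ℝ)..t, (a.2 s - b.2 s) := by
    refine intervalIntegral.integral_congr_ae ?_
    rw [uIoc_of_le ht.1]
    exact ae_Ioc_of_ae_timeMeasure ht (Lp.coeFn_sub a.2 b.2)
  rw [Arc.val, h, intervalIntegral.integral_sub (intervalIntegrable_L2 _ ht)
    (intervalIntegrable_L2 _ ht), Arc.val, Arc.val, Prod.fst_sub]
  abel

theorem Arc.val_smul (c : ℝ) (a : Arc T d) {t : ℝ} (ht : t ∈ Icc 0 T) :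
    (c • a).val t = c • a.val t := by
  have h : ∫ s in (0 : ℝ)..t, (c • a).2 s = ∫ s in (0 : ℝ)..t, c • a.2 s := by
    refine intervalIntegral.integral_congr_ae ?_
    rw [uIoc_of_le ht.1]
    exact ae_Ioc_of_ae_timeMeasure ht (Lp.coeFn_smul c a.2)
  rw [Arc.val, h, intervalIntegral.integral_smul, Arc.val, Prod.smul_fst, smul_add]

theorem Arc.continuousOn_val (a : Arc T d) : ContinuousOn a.val (Icc 0 T) := by
  rcases lt_or_ge T 0 with hT | hT
  · simp [Icc_eq_empty hT.not_ge]
  have := intervalIntegral.continuousOn_primitive_interval (μ := volume) (f := a.2) (a := 0)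
    (b := T) (by rw [uIcc_of_le hT]; exact integrableOn_L2 a.2)
  rw [uIcc_of_le hT] at this
  exact continuousOn_const.add this

/-- Sobolev embedding of `W^{1,2}([0, T])` into the continuous functions. -/
theorem Arc.norm_val_le (hT : 0 < T) (a : Arc T d) {t : ℝ} (ht : t ∈ Icc 0 T) :
    ‖a.val t‖ ≤ (1 + Real.sqrt T) * ‖a‖ := by
  have h1 : ‖∫ s in (0 : ℝ)..t, a.2 s‖ ≤ Real.sqrt T * ‖a.2‖ := by
    refine (intervalIntegral.norm_integral_le_integral_norm ht.1).trans
      (le_trans ?_ (integral_norm_L2_le hT a.2))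
    rw [intervalIntegral.integral_of_le ht.1]
    exact setIntegral_mono_set (integrableOn_L2 a.2).norm
      (Filter.Eventually.of_forall fun _ => norm_nonneg _)
      (LE.le.eventuallyLE fun s hs => ⟨hs.1.le, hs.2.trans ht.2⟩)
  have h2 := norm_fst_le a
  have h3 := norm_snd_le a
  calc ‖a.val t‖ ≤ ‖a.1‖ + Real.sqrt T * ‖a.2‖ := (norm_add_le _ _).trans (by gcongr)
    _ ≤ ‖a‖ + Real.sqrt T * ‖a‖ := by gcongr
    _ = _ := by ring

theorem Arc.aestronglyMeasurable_val (a : Arc T d) :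
    AEStronglyMeasurable a.val (timeMeasure T) :=
  a.continuousOn_val.aestronglyMeasurable measurableSet_Icc

theorem Arc.continuous_eval (hT : 0 < T) {t : ℝ} (ht : t ∈ Icc 0 T) :
    Continuous fun a : Arc T d => a.val t := by
  refine continuous_iff_continuousAt.2 fun a₀ => ?_
  rw [ContinuousAt, tendsto_iff_norm_sub_tendsto_zero]
  have h : Filter.Tendsto (fun a : Arc T d => (1 + Real.sqrt T) * ‖a - a₀‖) (nhds a₀) (nhds 0) := by
    have : Continuous fun a : Arc T d => (1 + Real.sqrt T) * ‖a - a₀‖ := by fun_prop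
    simpa using this.tendsto a₀
  refine squeeze_zero (fun _ => norm_nonneg _) (fun a => ?_) h
  rw [← Arc.val_sub a a₀ ht]
  exact Arc.norm_val_le hT _ ht

theorem Arc.norm_sq_le_normSq (a : Arc T d) :
    ‖a.1‖ ^ 2 ≤ a.normSq ∧ ‖a.2‖ ^ 2 ≤ a.normSq := by
  have : 0 ≤ ∫ t, ‖a.val t‖ ^ 2 ∂(timeMeasure T) := integral_nonneg fun _ => by positivity
  constructor <;> rw [Arc.normSq] <;> nlinarith [sq_nonneg ‖a.1‖, sq_nonneg ‖a.2‖,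
    sq_nonneg ‖a.val T‖]

theorem Arc.normSq_smul (hT : 0 < T) (c : ℝ) (a : Arc T d) :
    (c • a).normSq = c ^ 2 * a.normSq := by
  have h : ∫ t, ‖(c • a).val t‖ ^ 2 ∂(timeMeasure T)
      = c ^ 2 * ∫ t, ‖a.val t‖ ^ 2 ∂(timeMeasure T) := by
    rw [← integral_const_mul]
    refine setIntegral_congr_fun measurableSet_Icc fun t ht => ?_
    simp only [Arc.val_smul c a ht, norm_smul, mul_pow, Real.norm_eq_abs, sq_abs]
  rw [Arc.normSq, h, Arc.val_smul c a ⟨hT.le, le_rfl⟩, Prod.smul_snd, Prod.smul_fst, norm_smul,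
    norm_smul, norm_smul, Arc.normSq]
  simp only [mul_pow, Real.norm_eq_abs, sq_abs]
  ring

end Arcs

namespace PD

variable {T : ℝ} {n m k : ℕ}

theorem norm_le_nrm (d : PD T n m k) : ‖d‖ ≤ d.nrm := by
  obtain ⟨hx1, hx2⟩ := Arc.norm_sq_le_normSq d.xArc
  obtain ⟨hp1, hp2⟩ := Arc.norm_sq_le_normSq d.pArc
  have h1 := sq_nonneg ‖d.xArc.1‖
  have h2 := sq_nonneg ‖d.pArc.1‖
  have h3 := sq_nonneg ‖d.u‖
  have h4 := sq_nonneg ‖d.lam‖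
  refine max_le (max_le ?_ ?_) (max_le ?_ (max_le (max_le ?_ ?_) ?_)) <;>
    refine Real.le_sqrt_of_sq_le ?_
  · change ‖d.xArc.1‖ ^ 2 ≤ _; linarith
  · change ‖d.xArc.2‖ ^ 2 ≤ _; linarith
  · change ‖d.u‖ ^ 2 ≤ _; linarith
  · change ‖d.pArc.1‖ ^ 2 ≤ _; linarith
  · change ‖d.pArc.2‖ ^ 2 ≤ _; linarith
  · change ‖d.lam‖ ^ 2 ≤ _; linarith

theorem nrm_smul (hT : 0 < T) {c : ℝ} (hc : 0 ≤ c) (d : PD T n m k) :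
    (c • d).nrm = c * d.nrm := by
  have h : (c • d).xArc.normSq + ‖(c • d).u‖ ^ 2 + (c • d).pArc.normSq + ‖(c • d).lam‖ ^ 2
      = c ^ 2 * (d.xArc.normSq + ‖d.u‖ ^ 2 + d.pArc.normSq + ‖d.lam‖ ^ 2) := by
    have h1 : (c • d).xArc = c • d.xArc := rfl
    have h2 : (c • d).pArc = c • d.pArc := rfl
    have h3 : (c • d).u = c • d.u := rfl
    have h4 : (c • d).lam = c • d.lam := rfl
    rw [h1, h2, h3, h4, Arc.normSq_smul hT, Arc.normSq_smul hT, norm_smul, norm_smul,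
      Real.norm_eq_abs, abs_of_nonneg hc]
    ring
  rw [nrm, h, Real.sqrt_mul (sq_nonneg c), Real.sqrt_sq hc, nrm]

theorem norm_u_le (d : PD T n m k) : ‖d.u‖ ≤ ‖d‖ := (norm_fst_le d.2).trans (norm_snd_le d)

theorem norm_lam_le (d : PD T n m k) : ‖d.lam‖ ≤ ‖d‖ :=
  (norm_snd_le d.2.2).trans ((norm_snd_le d.2).trans (norm_snd_le d))

theorem norm_x_le (hT : 0 < T) (d : PD T n m k) {t : ℝ} (ht : t ∈ Icc 0 T) :
    ‖d.x t‖ ≤ (1 + Real.sqrt T) * ‖d‖ :=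
  (Arc.norm_val_le hT d.xArc ht).trans (by gcongr; exact norm_fst_le d)

theorem norm_p_le (hT : 0 < T) (d : PD T n m k) {t : ℝ} (ht : t ∈ Icc 0 T) :
    ‖d.p t‖ ≤ (1 + Real.sqrt T) * ‖d‖ :=
  (Arc.norm_val_le hT d.pArc ht).trans (by
    gcongr; exact (norm_fst_le d.2.2).trans ((norm_snd_le d.2).trans (norm_snd_le d)))

end PD

end Bolza

/-! ### The KKT mapping as a superposition operator and its linearization -/

namespace Bolza

/-- The pointwise values `(x, u, p)(t)` of a primal-dual variable. -/
noncomputable def PD.tr {T : ℝ} {n m k : ℕ} (z : PD T n m k) (t : ℝ) : E n × E m × E n :=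
  (z.x t, z.u t, z.p t)

/-- The boundary values and the multiplier, `(x(0), x(T), p(0), p(T), lam)`. -/
noncomputable def PD.bd {T : ℝ} {n m k : ℕ} (z : PD T n m k) : E n × E n × E n × E n × E k :=
  (z.x 0, z.x T, z.p 0, z.p T, z.lam)

/-- The differentiated part `(ẋ, -ṗ, 0)` of the KKT system. -/
noncomputable def PD.dot {T : ℝ} {n m k : ℕ} (z : PD T n m k) (t : ℝ) : E n × E n × E m :=
  (z.xdot t, -z.pdot t, 0)

/-- The pointwise values of the first three components of a residual. -/
noncomputable def Res.tr {T : ℝ} {n m k : ℕ} (r : Res T n m k) (t : ℝ) :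
    E n × E n × E m := (r.1 t, r.2.1 t, r.2.2.1 t)

end Bolza

namespace BolzaProblem

open Bolza

variable {T : ℝ} {n m k : ℕ} (P : BolzaProblem n m k)

/-- The superposition part `(f, H_x, -H_u)` of the KKT system, so that
`(F₁, F₂, F₃) = (ẋ, -ṗ, 0) - (f, H_x, -H_u)`. -/
noncomputable def field (y : ℝ × E n × E m × E n) : E n × E n × E m :=
  (P.f y.1 y.2.1 y.2.2.1, P.Hx y.1 y.2.1 y.2.2.1 y.2.2.2, -P.Hu y.1 y.2.1 y.2.2.1 y.2.2.2)

/-- The finite-dimensional part `(F₄, F₅, F₆)` of the KKT system. -/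
noncomputable def bdry (y : E n × E n × E n × E n × E k) : E k × E n × E n :=
  (P.b y.1 y.2.1, P.bcT y.1 y.2.1 y.2.2.2.1 y.2.2.2.2, P.bc0 y.1 y.2.1 y.2.2.1 y.2.2.2.2)

/-- The derivative of the superposition part of the KKT system at time `t` along `z`. -/
noncomputable def fieldDeriv (z : PD T n m k) (t : ℝ) :
    (E n × E m × E n) →L[ℝ] E n × E n × E m :=
  fderiv ℝ (fun q => P.field (t, q)) (z.tr t)

section Slices

variable {X Y W : Type*} [NormedAddCommGroup X] [NormedSpace ℝ X] [NormedAddCommGroup Y]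
  [NormedSpace ℝ Y] [NormedAddCommGroup W] [NormedSpace ℝ W]

theorem hasFDerivAt_left {g : X × Y → W} {g' : X × Y →L[ℝ] W} {x : X} {y : Y}
    (h : HasFDerivAt g g' (x, y)) :
    HasFDerivAt (fun x => g (x, y)) (g'.comp (ContinuousLinearMap.inl ℝ X Y)) x :=
  HasFDerivAt.comp (f := fun x => (x, y)) x h (hasFDerivAt_prodMk_left x y)

theorem hasFDerivAt_right {g : X × Y → W} {g' : X × Y →L[ℝ] W} {x : X} {y : Y}
    (h : HasFDerivAt g g' (x, y)) :
    HasFDerivAt (fun y => g (x, y)) (g'.comp (ContinuousLinearMap.inr ℝ X Y)) y :=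
  HasFDerivAt.comp (f := fun y => (x, y)) y h (hasFDerivAt_prodMk_right x y)

end Slices

section Smoothness

variable {P}

theorem contDiffOn_H (hP : P.IsC2 T) :
    ContDiffOn ℝ 2 (fun y : ℝ × E n × E m × E n => P.H y.1 y.2.1 y.2.2.1 y.2.2.2)
      (Icc 0 T ×ˢ univ) := by
  have hsub : ContDiff ℝ 2 (fun y : ℝ × E n × E m × E n => (y.1, y.2.1, y.2.2.1)) := by fun_prop
  have hmaps : MapsTo (fun y : ℝ × E n × E m × E n => (y.1, y.2.1, y.2.2.1))
      (Icc 0 T ×ˢ univ) (Icc 0 T ×ˢ univ) := fun y hy => ⟨hy.1, mem_univ _⟩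
  have hL := hP.L.comp hsub.contDiffOn hmaps
  have hf := hP.f.comp hsub.contDiffOn hmaps
  have hp : ContDiffOn ℝ 2 (fun y : ℝ × E n × E m × E n => y.2.2.2) (Icc 0 T ×ˢ univ) := by
    fun_prop
  exact hL.add (hp.inner ℝ hf)

theorem contDiffOn_gradient_slice (hT : 0 < T) {V : Type*} [NormedAddCommGroup V] [NormedSpace ℝ V]
    {d : ℕ} {g : ℝ × V → ℝ} (hg : ContDiffOn ℝ 2 g (Icc 0 T ×ˢ univ)) (ι : E d →L[ℝ] V) :
    ContDiffOn ℝ 1 (fun y : ℝ × V => (InnerProductSpace.toDual ℝ (E d)).symm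
      ((fderiv ℝ (fun q => g (y.1, q)) y.2).comp ι)) (Icc 0 T ×ˢ univ) := by
  have h1 := contDiffOn_fderiv_slice (j := 1) hT (g := g) (by exact_mod_cast hg)
  exact (isBoundedLinearMap_toDual_symm d).contDiff.comp_contDiffOn
    (h1.clm_comp (contDiffOn_const (c := ι)))

theorem contDiffOn_Hx (hT : 0 < T) (hP : P.IsC2 T) :
    ContDiffOn ℝ 1 (fun y : ℝ × E n × E m × E n => P.Hx y.1 y.2.1 y.2.2.1 y.2.2.2)
      (Icc 0 T ×ˢ univ) := by
  refine (contDiffOn_gradient_slice hT (contDiffOn_H hP)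
    (ContinuousLinearMap.inl ℝ (E n) (E m × E n))).congr ?_
  rintro ⟨t, x, u, p⟩ ⟨ht, -⟩
  have h := (differentiable_slice ((contDiffOn_H hP).of_le one_le_two) ht (x, u, p)).hasFDerivAt
  exact congrArg _ (hasFDerivAt_left h).fderiv

theorem contDiffOn_Hu (hT : 0 < T) (hP : P.IsC2 T) :
    ContDiffOn ℝ 1 (fun y : ℝ × E n × E m × E n => P.Hu y.1 y.2.1 y.2.2.1 y.2.2.2)
      (Icc 0 T ×ˢ univ) := by
  refine (contDiffOn_gradient_slice hT (contDiffOn_H hP)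
    ((ContinuousLinearMap.inr ℝ (E n) (E m × E n)).comp
      (ContinuousLinearMap.inl ℝ (E m) (E n)))).congr ?_
  rintro ⟨t, x, u, p⟩ ⟨ht, -⟩
  have h := (differentiable_slice ((contDiffOn_H hP).of_le one_le_two) ht (x, u, p)).hasFDerivAt
  exact congrArg _ (hasFDerivAt_left (hasFDerivAt_right h)).fderiv

theorem contDiffOn_field (hT : 0 < T) (hP : P.IsC2 T) :
    ContDiffOn ℝ 1 P.field (Icc 0 T ×ˢ univ) := by
  have hsub : ContDiff ℝ 2 (fun y : ℝ × E n × E m × E n => (y.1, y.2.1, y.2.2.1)) := by fun_prop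
  have hmaps : MapsTo (fun y : ℝ × E n × E m × E n => (y.1, y.2.1, y.2.2.1))
      (Icc 0 T ×ˢ univ) (Icc 0 T ×ˢ univ) := fun y hy => ⟨hy.1, mem_univ _⟩
  have hf := (hP.f.comp hsub.contDiffOn hmaps).of_le one_le_two
  exact hf.prodMk ((contDiffOn_Hx hT hP).prodMk (contDiffOn_Hu hT hP).neg)

theorem contDiff_partial_left {W : Type*} [NormedAddCommGroup W] [NormedSpace ℝ W]
    {g : E n × E n → W} (hg : ContDiff ℝ 2 g) :
    ContDiff ℝ 1 (fun y : E n × E n => fderiv ℝ (fun x => g (x, y.2)) y.1) := by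
  have h1 : ContDiff ℝ 1 (fderiv ℝ g) := hg.fderiv_right (by norm_num)
  have h2 : (fun y : E n × E n => fderiv ℝ (fun x => g (x, y.2)) y.1)
      = fun y => (fderiv ℝ g y).comp (ContinuousLinearMap.inl ℝ (E n) (E n)) := by
    funext y
    exact (hasFDerivAt_left ((hg.differentiable two_ne_zero) y).hasFDerivAt).fderiv
  rw [h2]
  exact h1.clm_comp contDiff_const

theorem contDiff_partial_right {W : Type*} [NormedAddCommGroup W] [NormedSpace ℝ W]
    {g : E n × E n → W} (hg : ContDiff ℝ 2 g) :
    ContDiff ℝ 1 (fun y : E n × E n => fderiv ℝ (fun x => g (y.1, x)) y.2) := by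
  have h1 : ContDiff ℝ 1 (fderiv ℝ g) := hg.fderiv_right (by norm_num)
  have h2 : (fun y : E n × E n => fderiv ℝ (fun x => g (y.1, x)) y.2)
      = fun y => (fderiv ℝ g y).comp (ContinuousLinearMap.inr ℝ (E n) (E n)) := by
    funext y
    exact (hasFDerivAt_right ((hg.differentiable two_ne_zero) y).hasFDerivAt).fderiv
  rw [h2]
  exact h1.clm_comp contDiff_const

theorem contDiff_bcT (hP : P.IsC2 T) :
    ContDiff ℝ 1 (fun q : E n × E n × E n × E k => P.bcT q.1 q.2.1 q.2.2.1 q.2.2.2) := by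
  have h12 : ContDiff ℝ 1 (fun q : E n × E n × E n × E k => (q.1, q.2.1)) := by fun_prop
  have hK := (isBoundedLinearMap_toDual_symm n).contDiff.comp
    ((contDiff_partial_right hP.K).comp h12)
  have hb := (isBoundedLinearMap_adjoint n k).contDiff.comp
    ((contDiff_partial_right hP.b).comp h12)
  have hp : ContDiff ℝ 1 (fun q : E n × E n × E n × E k => q.2.2.1) := by fun_prop
  have hl : ContDiff ℝ 1 (fun q : E n × E n × E n × E k => q.2.2.2) := by fun_prop
  exact (hp.sub hK).sub (hb.clm_apply hl)

theorem contDiff_bc0 (hP : P.IsC2 T) :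
    ContDiff ℝ 1 (fun q : E n × E n × E n × E k => P.bc0 q.1 q.2.1 q.2.2.1 q.2.2.2) := by
  have h12 : ContDiff ℝ 1 (fun q : E n × E n × E n × E k => (q.1, q.2.1)) := by fun_prop
  have hK := (isBoundedLinearMap_toDual_symm n).contDiff.comp
    ((contDiff_partial_left hP.K).comp h12)
  have hb := (isBoundedLinearMap_adjoint n k).contDiff.comp
    ((contDiff_partial_left hP.b).comp h12)
  have hp : ContDiff ℝ 1 (fun q : E n × E n × E n × E k => q.2.2.1) := by fun_prop
  have hl : ContDiff ℝ 1 (fun q : E n × E n × E n × E k => q.2.2.2) := by fun_prop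
  exact (hp.neg.sub hK).sub (hb.clm_apply hl)

theorem contDiff_bdry (hP : P.IsC2 T) : ContDiff ℝ 1 P.bdry := by
  have h1 : ContDiff ℝ 1 (fun y : E n × E n × E n × E n × E k => P.b y.1 y.2.1) :=
    (hP.b.of_le one_le_two).comp (f := fun y : E n × E n × E n × E n × E k => (y.1, y.2.1))
      (by fun_prop)
  have h2 : ContDiff ℝ 1 (fun y : E n × E n × E n × E n × E k =>
      P.bcT y.1 y.2.1 y.2.2.2.1 y.2.2.2.2) :=
    (contDiff_bcT hP).comp (f := fun y : E n × E n × E n × E n × E k =>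
      (y.1, y.2.1, y.2.2.2.1, y.2.2.2.2)) (by fun_prop)
  have h3 : ContDiff ℝ 1 (fun y : E n × E n × E n × E n × E k =>
      P.bc0 y.1 y.2.1 y.2.2.1 y.2.2.2.2) :=
    (contDiff_bc0 hP).comp (f := fun y : E n × E n × E n × E n × E k =>
      (y.1, y.2.1, y.2.2.1, y.2.2.2.2)) (by fun_prop)
  exact h1.prodMk (h2.prodMk h3)

/-- The boundary part of the KKT system is affine in the multiplier, so its increments in that
variable are given exactly by its derivative. -/
theorem fderiv_bdry_lam (hP : P.IsC2 T) (x₀ xT p₀ pT : E n) (l μ : E k) :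
    fderiv ℝ P.bdry (x₀, xT, p₀, pT, l) (0, 0, 0, 0, μ)
      = P.bdry (x₀, xT, p₀, pT, l + μ) - P.bdry (x₀, xT, p₀, pT, l) := by
  set y : E n × E n × E n × E n × E k := (x₀, xT, p₀, pT, l) with hy
  set w : E n × E n × E n × E n × E k := (0, 0, 0, 0, μ) with hw
  set c := P.bdry (x₀, xT, p₀, pT, l + μ) - P.bdry y with hc
  have h1 : HasLineDerivAt ℝ P.bdry (fderiv ℝ P.bdry y w) y w :=
    (((contDiff_bdry hP).differentiable one_ne_zero) y).hasFDerivAt.hasLineDerivAt w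
  have h2 : HasLineDerivAt ℝ P.bdry c y w := by
    have h3 : (fun s : ℝ => P.bdry (y + s • w)) = fun s => P.bdry y + s • c := by
      funext s
      simp only [hc, hy, hw, bdry, bcT, bc0, Prod.smul_mk, smul_zero, Prod.mk_add_mk, add_zero,
        map_add, map_smul, Prod.mk_sub_mk, Prod.mk.injEq]
      refine ⟨by simp, ?_, ?_⟩ <;> module
    rw [HasLineDerivAt, h3]
    simpa using ((hasDerivAt_id (0 : ℝ)).smul_const c).const_add (P.bdry y)
  exact h1.unique h2

end Smoothness

section Linearization

variable {P}

theorem hasFDerivAt_field (hT : 0 < T) (hP : P.IsC2 T) {t : ℝ} (ht : t ∈ Icc 0 T)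
    (q : E n × E m × E n) :
    HasFDerivAt (fun q => P.field (t, q)) (fderiv ℝ (fun q => P.field (t, q)) q) q :=
  (differentiable_slice (contDiffOn_field hT hP) ht q).hasFDerivAt

theorem hasFDerivAt_field_Hu (hT : 0 < T) (hP : P.IsC2 T) {t : ℝ} (ht : t ∈ Icc 0 T)
    (q : E n × E m × E n) :
    HasFDerivAt (fun q : E n × E m × E n => P.Hu t q.1 q.2.1 q.2.2)
      (-((ContinuousLinearMap.snd ℝ (E n) (E m)).comp
        ((ContinuousLinearMap.snd ℝ (E n) (E n × E m)).comp
        (fderiv ℝ (fun q => P.field (t, q)) q)))) q := by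
  have h : (fun q : E n × E m × E n => P.Hu t q.1 q.2.1 q.2.2)
      = -fun q : E n × E m × E n => (P.field (t, q)).2.2 := by
    funext q
    simp [field]
  rw [h]
  exact (hasFDerivAt_field hT hP ht q).snd.snd.neg

theorem fderiv_field (hT : 0 < T) (hP : P.IsC2 T) {t : ℝ} (ht : t ∈ Icc 0 T)
    (q w : E n × E m × E n) :
    fderiv ℝ (fun q => P.field (t, q)) q w =
      (fderiv ℝ (fun q : E n × E m => P.f t q.1 q.2) (q.1, q.2.1) (w.1, w.2.1),
        fderiv ℝ (fun q : E n × E m × E n => P.Hx t q.1 q.2.1 q.2.2) q w,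
        -fderiv ℝ (fun q : E n × E m × E n => P.Hu t q.1 q.2.1 q.2.2) q w) := by
  have h := hasFDerivAt_field hT hP ht q
  have h1 := hasFDerivAt_fst.comp q h
  have h2 := hasFDerivAt_fst.comp q (hasFDerivAt_snd.comp q h)
  have hf := (differentiable_slice (hP.f.of_le one_le_two) ht (q.1, q.2.1)).hasFDerivAt
  have hf' := hf.comp q (hasFDerivAt_fst.prodMk
    (hasFDerivAt_fst.comp q (hasFDerivAt_snd (𝕜 := ℝ) (p := q))))
  refine Prod.ext ?_ (Prod.ext ?_ ?_)
  · exact (DFunLike.congr_fun (hf'.unique h1) w).symm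
  · exact (DFunLike.congr_fun h2.fderiv w).symm
  · rw [(hasFDerivAt_field_Hu hT hP ht q).fderiv]; simp

theorem Hux_apply (hT : 0 < T) (hP : P.IsC2 T) {t : ℝ} (ht : t ∈ Icc 0 T)
    (x : E n) (u : E m) (p ξ : E n) :
    P.Hux t x u p ξ = -(fderiv ℝ (fun q => P.field (t, q)) (x, u, p) (ξ, 0, 0)).2.2 :=
  DFunLike.congr_fun (hasFDerivAt_left (hasFDerivAt_field_Hu hT hP ht (x, u, p))).fderiv ξ

theorem Huu_apply (hT : 0 < T) (hP : P.IsC2 T) {t : ℝ} (ht : t ∈ Icc 0 T)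
    (x : E n) (u : E m) (p : E n) (v : E m) :
    P.Huu t x u p v = -(fderiv ℝ (fun q => P.field (t, q)) (x, u, p) (0, v, 0)).2.2 :=
  DFunLike.congr_fun (hasFDerivAt_left (hasFDerivAt_right
    (hasFDerivAt_field_Hu hT hP ht (x, u, p)))).fderiv v

theorem Hup_apply (hT : 0 < T) (hP : P.IsC2 T) {t : ℝ} (ht : t ∈ Icc 0 T)
    (x : E n) (u : E m) (p π : E n) :
    P.Hup t x u p π = -(fderiv ℝ (fun q => P.field (t, q)) (x, u, p) (0, 0, π)).2.2 :=
  DFunLike.congr_fun (hasFDerivAt_right (hasFDerivAt_right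
    (hasFDerivAt_field_Hu hT hP ht (x, u, p)))).fderiv π

theorem fderiv_f_left_apply (hT : 0 < T) (hP : P.IsC2 T) {t : ℝ} (ht : t ∈ Icc 0 T)
    (x : E n) (u : E m) (p ξ : E n) :
    fderiv ℝ (fun y => P.f t y u) x ξ
      = (fderiv ℝ (fun q => P.field (t, q)) (x, u, p) (ξ, 0, 0)).1 :=
  DFunLike.congr_fun (hasFDerivAt_left (hasFDerivAt_field hT hP ht (x, u, p)).fst).fderiv ξ

theorem fderiv_f_right_apply (hT : 0 < T) (hP : P.IsC2 T) {t : ℝ} (ht : t ∈ Icc 0 T)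
    (x : E n) (u : E m) (p : E n) (v : E m) :
    fderiv ℝ (fun v => P.f t x v) u v
      = (fderiv ℝ (fun q => P.field (t, q)) (x, u, p) (0, v, 0)).1 :=
  DFunLike.congr_fun (hasFDerivAt_left (hasFDerivAt_right
    (hasFDerivAt_field hT hP ht (x, u, p)).fst)).fderiv v

theorem fderiv_bdry (hP : P.IsC2 T) (y w : E n × E n × E n × E n × E k) :
    fderiv ℝ P.bdry y w =
      (fderiv ℝ (fun q : E n × E n => P.b q.1 q.2) (y.1, y.2.1) (w.1, w.2.1),
        fderiv ℝ (fun q : E n × E n × E n × E k => P.bcT q.1 q.2.1 q.2.2.1 q.2.2.2)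
          (y.1, y.2.1, y.2.2.2.1, y.2.2.2.2) (w.1, w.2.1, w.2.2.2.1, w.2.2.2.2),
        fderiv ℝ (fun q : E n × E n × E n × E k => P.bc0 q.1 q.2.1 q.2.2.1 q.2.2.2)
          (y.1, y.2.1, y.2.2.1, y.2.2.2.2) (w.1, w.2.1, w.2.2.1, w.2.2.2.2)) := by
  let ℓ₁ : (E n × E n × E n × E n × E k) →L[ℝ] E n × E n :=
    { toFun := fun y => (y.1, y.2.1)
      map_add' := fun _ _ => rfl
      map_smul' := fun _ _ => rfl
      cont := by fun_prop }
  let ℓ₂ : (E n × E n × E n × E n × E k) →L[ℝ] E n × E n × E n × E k :=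
    { toFun := fun y => (y.1, y.2.1, y.2.2.2.1, y.2.2.2.2)
      map_add' := fun _ _ => rfl
      map_smul' := fun _ _ => rfl
      cont := by fun_prop }
  let ℓ₃ : (E n × E n × E n × E n × E k) →L[ℝ] E n × E n × E n × E k :=
    { toFun := fun y => (y.1, y.2.1, y.2.2.1, y.2.2.2.2)
      map_add' := fun _ _ => rfl
      map_smul' := fun _ _ => rfl
      cont := by fun_prop }
  have h1 := ((hP.b.differentiable two_ne_zero) (ℓ₁ y)).hasFDerivAt.comp y ℓ₁.hasFDerivAt
  have h2 := (((contDiff_bcT hP).differentiable one_ne_zero) (ℓ₂ y)).hasFDerivAt.comp y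
    ℓ₂.hasFDerivAt
  have h3 := (((contDiff_bc0 hP).differentiable one_ne_zero) (ℓ₃ y)).hasFDerivAt.comp y
    ℓ₃.hasFDerivAt
  exact DFunLike.congr_fun (h1.prodMk (h2.prodMk h3)).fderiv w

theorem isKKT_iff (z : PD T n m k) :
    P.IsKKT z ↔ (∀ᵐ t ∂(timeMeasure T), z.dot t = P.field (t, z.tr t)) ∧ P.bdry z.bd = 0 := by
  have h1 : (∀ᵐ t ∂(timeMeasure T), z.dot t = P.field (t, z.tr t)) ↔
      (∀ᵐ t ∂(timeMeasure T), P.F1 z t = 0) ∧ (∀ᵐ t ∂(timeMeasure T), P.F2 z t = 0) ∧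
        (∀ᵐ t ∂(timeMeasure T), P.F3 z t = 0) := by
    rw [← Filter.eventually_and, ← Filter.eventually_and]
    refine Filter.eventually_congr (Filter.Eventually.of_forall fun t => ?_)
    simp only [PD.dot, field, PD.tr, F1, F2, F3, Prod.mk.injEq, sub_eq_zero, zero_eq_neg]
  rw [h1, IsKKT]
  simp only [bdry, PD.bd, F4, F5, F6, Prod.mk_eq_zero, and_assoc]

theorem linKKT_iff (hT : 0 < T) (hP : P.IsC2 T) (z d : PD T n m k) (r : Res T n m k) :
    P.LinKKT z d r ↔
      (∀ᵐ t ∂(timeMeasure T), d.dot t - P.fieldDeriv z t (d.tr t) = r.tr t) ∧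
      fderiv ℝ P.bdry z.bd d.bd = r.2.2.2 := by
  have h1 : (∀ᵐ t ∂(timeMeasure T), d.dot t - P.fieldDeriv z t (d.tr t) = r.tr t) ↔
      (∀ᵐ t ∂(timeMeasure T), d.xdot t - fderiv ℝ (fun q : E n × E m => P.f t q.1 q.2)
        (z.x t, z.u t) (d.x t, d.u t) = r.1 t) ∧
      (∀ᵐ t ∂(timeMeasure T), -d.pdot t - fderiv ℝ (fun q : E n × E m × E n =>
        P.Hx t q.1 q.2.1 q.2.2) (z.x t, z.u t, z.p t) (d.x t, d.u t, d.p t) = r.2.1 t) ∧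
      (∀ᵐ t ∂(timeMeasure T), fderiv ℝ (fun q : E n × E m × E n =>
        P.Hu t q.1 q.2.1 q.2.2) (z.x t, z.u t, z.p t) (d.x t, d.u t, d.p t) = r.2.2.1 t) := by
    rw [← Filter.eventually_and, ← Filter.eventually_and]
    refine Filter.eventually_congr ?_
    filter_upwards [ae_restrict_mem measurableSet_Icc] with t ht
    rw [fieldDeriv, fderiv_field hT hP ht, PD.dot, Res.tr, Prod.mk_sub_mk, Prod.mk_sub_mk,
      Prod.mk.injEq, Prod.mk.injEq]
    simp only [PD.tr, zero_sub, neg_neg]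
  rw [h1, fderiv_bdry hP, Prod.ext_iff, Prod.ext_iff, LinKKT, and_assoc, and_assoc]
  rfl

end Linearization

end BolzaProblem

/-! ### Strong regularity as a bound for the inverse -/

namespace Bolza

variable {T : ℝ} {n m k : ℕ}

namespace PD

theorem ae_tr_sub (z w : PD T n m k) :
    ∀ᵐ t ∂(timeMeasure T), (z - w).tr t = z.tr t - w.tr t := by
  filter_upwards [ae_restrict_mem measurableSet_Icc, Lp.coeFn_sub z.u w.u] with t ht hu
  exact Prod.ext (Arc.val_sub _ _ ht) (Prod.ext hu (Arc.val_sub _ _ ht))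

theorem ae_tr_smul (c : ℝ) (z : PD T n m k) :
    ∀ᵐ t ∂(timeMeasure T), (c • z).tr t = c • z.tr t := by
  filter_upwards [ae_restrict_mem measurableSet_Icc, Lp.coeFn_smul c z.u] with t ht hu
  exact Prod.ext (Arc.val_smul _ _ ht) (Prod.ext hu (Arc.val_smul _ _ ht))

theorem ae_dot_sub (z w : PD T n m k) :
    ∀ᵐ t ∂(timeMeasure T), (z - w).dot t = z.dot t - w.dot t := by
  filter_upwards [Lp.coeFn_sub z.xdot w.xdot, Lp.coeFn_sub z.pdot w.pdot] with t hx hp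
  refine Prod.ext hx (Prod.ext ?_ (sub_zero 0).symm)
  change -((z.pdot - w.pdot : L2 T n) t) = -z.pdot t - -w.pdot t
  rw [hp, Pi.sub_apply]
  abel

theorem ae_dot_smul (c : ℝ) (z : PD T n m k) :
    ∀ᵐ t ∂(timeMeasure T), (c • z).dot t = c • z.dot t := by
  filter_upwards [Lp.coeFn_smul c z.xdot, Lp.coeFn_smul c z.pdot] with t hx hp
  refine Prod.ext hx (Prod.ext ?_ (smul_zero c).symm)
  change -((c • z.pdot : L2 T n) t) = c • -z.pdot t
  rw [hp, Pi.smul_apply, smul_neg]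

theorem bd_sub (hT : 0 < T) (z w : PD T n m k) : (z - w).bd = z.bd - w.bd := by
  have h0 : (0 : ℝ) ∈ Icc 0 T := ⟨le_rfl, hT.le⟩
  have h1 : T ∈ Icc 0 T := ⟨hT.le, le_rfl⟩
  exact Prod.ext (Arc.val_sub _ _ h0) (Prod.ext (Arc.val_sub _ _ h1) (Prod.ext (Arc.val_sub _ _ h0)
    (Prod.ext (Arc.val_sub _ _ h1) rfl)))

theorem bd_smul (hT : 0 < T) (c : ℝ) (z : PD T n m k) : (c • z).bd = c • z.bd := by
  have h0 : (0 : ℝ) ∈ Icc 0 T := ⟨le_rfl, hT.le⟩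
  have h1 : T ∈ Icc 0 T := ⟨hT.le, le_rfl⟩
  exact Prod.ext (Arc.val_smul _ _ h0) (Prod.ext (Arc.val_smul _ _ h1) (Prod.ext
    (Arc.val_smul _ _ h0) (Prod.ext (Arc.val_smul _ _ h1) rfl)))

theorem x_sub (z w : PD T n m k) {t : ℝ} (ht : t ∈ Icc 0 T) : (z - w).x t = z.x t - w.x t :=
  Arc.val_sub _ _ ht

theorem p_sub (z w : PD T n m k) {t : ℝ} (ht : t ∈ Icc 0 T) : (z - w).p t = z.p t - w.p t :=
  Arc.val_sub _ _ ht

theorem ae_u_sub (z w : PD T n m k) :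
    ∀ᵐ t ∂(timeMeasure T), (z - w).u t = z.u t - w.u t := Lp.coeFn_sub z.u w.u

theorem aestronglyMeasurable_tr (z : PD T n m k) :
    AEStronglyMeasurable z.tr (timeMeasure T) :=
  z.xArc.aestronglyMeasurable_val.prodMk
    ((Lp.aestronglyMeasurable z.u).prodMk z.pArc.aestronglyMeasurable_val)

theorem memLp_tr (hT : 0 < T) (z : PD T n m k) : MemLp z.tr 2 (timeMeasure T) := by
  refine memLp_prod_iff.2 ⟨?_, memLp_prod_iff.2 ⟨Lp.memLp z.u, ?_⟩⟩
  · refine MemLp.of_bound z.xArc.aestronglyMeasurable_val ((1 + Real.sqrt T) * ‖z‖) ?_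
    filter_upwards [ae_restrict_mem measurableSet_Icc] with t ht using z.norm_x_le hT ht
  · refine MemLp.of_bound z.pArc.aestronglyMeasurable_val ((1 + Real.sqrt T) * ‖z‖) ?_
    filter_upwards [ae_restrict_mem measurableSet_Icc] with t ht using z.norm_p_le hT ht

theorem memLp_dot (z : PD T n m k) : MemLp z.dot 2 (timeMeasure T) :=
  memLp_prod_iff.2 ⟨Lp.memLp z.xdot, memLp_prod_iff.2 ⟨(Lp.memLp z.pdot).neg, MemLp.zero⟩⟩

theorem ae_norm_tr_le (hT : 0 < T) (z : PD T n m k) :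
    ∀ᵐ t ∂(timeMeasure T), ‖z.tr t‖ ≤ (1 + Real.sqrt T) * ‖z‖ + ‖z.u t‖ := by
  filter_upwards [ae_restrict_mem measurableSet_Icc] with t ht
  have hx := z.norm_x_le hT ht
  have hp := z.norm_p_le hT ht
  have h0 : 0 ≤ (1 + Real.sqrt T) * ‖z‖ := by positivity
  have hu := norm_nonneg (z.u t)
  exact max_le (hx.trans (by linarith)) (max_le (le_add_of_nonneg_left h0) (hp.trans (by linarith)))

theorem norm_bd_le (hT : 0 < T) (z : PD T n m k) : ‖z.bd‖ ≤ (1 + Real.sqrt T) * ‖z‖ := by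
  have h0 : (0 : ℝ) ∈ Icc 0 T := ⟨le_rfl, hT.le⟩
  have h1 : T ∈ Icc 0 T := ⟨hT.le, le_rfl⟩
  have h2 : ‖z.lam‖ ≤ (1 + Real.sqrt T) * ‖z‖ :=
    z.norm_lam_le.trans (le_mul_of_one_le_left (norm_nonneg z) (by simp))
  exact max_le (z.norm_x_le hT h0) (max_le (z.norm_x_le hT h1) (max_le (z.norm_p_le hT h0)
    (max_le (z.norm_p_le hT h1) h2)))

end PD

theorem Res.nrm_nonneg (r : Res T n m k) : 0 ≤ r.nrm := by unfold Res.nrm; positivity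

theorem Res.nrm_smul {c : ℝ} (hc : 0 ≤ c) (r : Res T n m k) : (c • r).nrm = c * r.nrm := by
  simp only [Res.nrm, Prod.smul_fst, Prod.smul_snd, norm_smul, Real.norm_eq_abs, abs_of_nonneg hc]
  ring

theorem Res.ae_tr_smul (c : ℝ) (r : Res T n m k) :
    ∀ᵐ t ∂(timeMeasure T), (c • r).tr t = c • r.tr t := by
  filter_upwards [Lp.coeFn_smul c r.1, Lp.coeFn_smul c r.2.1, Lp.coeFn_smul c r.2.2.1]
    with t h1 h2 h3
  exact Prod.ext h1 (Prod.ext h2 h3)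

theorem Res.nrm_le (hT : 0 < T) (r : Res T n m k) (w : L2 T m) {c η b : ℝ} (hc : 0 ≤ c)
    (hη : 0 ≤ η) (hr : ∀ᵐ t ∂(timeMeasure T), ‖r.tr t‖ ≤ c + η * ‖w t‖) (hb : ‖r.2.2.2‖ ≤ b) :
    r.nrm ≤ 3 * (Real.sqrt T * c + η * ‖w‖) + 3 * b := by
  have h1 := norm_L2_le_of_affine_bound hT r.1 w hc hη
    (hr.mono fun t h => (norm_fst_le _).trans h)
  have h2 := norm_L2_le_of_affine_bound hT r.2.1 w hc hη
    (hr.mono fun t h => ((norm_fst_le _).trans (norm_snd_le _)).trans h)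
  have h3 := norm_L2_le_of_affine_bound hT r.2.2.1 w hc hη
    (hr.mono fun t h => ((norm_snd_le _).trans (norm_snd_le _)).trans h)
  have h4 := (norm_fst_le r.2.2.2).trans hb
  have h5 := ((norm_fst_le _).trans (norm_snd_le r.2.2.2)).trans hb
  have h6 := ((norm_snd_le _).trans (norm_snd_le r.2.2.2)).trans hb
  unfold Res.nrm
  linarith

theorem exists_res {g : ℝ → E n × E n × E m} (hg : MemLp g 2 (timeMeasure T))
    (b : E k × E n × E n) :
    ∃ r : Res T n m k, (∀ᵐ t ∂(timeMeasure T), r.tr t = g t) ∧ r.2.2.2 = b := by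
  obtain ⟨h1, h2⟩ := memLp_prod_iff.1 hg
  obtain ⟨h3, h4⟩ := memLp_prod_iff.1 h2
  refine ⟨(h1.toLp _, h3.toLp _, h4.toLp _, b), ?_, rfl⟩
  filter_upwards [h1.coeFn_toLp, h3.coeFn_toLp, h4.coeFn_toLp] with t a1 a2 a3
  exact Prod.ext a1 (Prod.ext a2 a3)

theorem ae_norm_le_toReal_essSup {F : Type*} [NormedAddCommGroup F] {μ : Measure ℝ} {g : ℝ → F}
    {C : ℝ} (h : ∀ᵐ t ∂μ, ‖g t‖ ≤ C) :
    ∀ᵐ t ∂μ, ‖g t‖ ≤ (eLpNorm g ∞ μ).toReal := by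
  have h1 : eLpNorm g ∞ μ ≤ ENNReal.ofReal C := by
    rw [eLpNorm_exponent_top]; exact eLpNormEssSup_le_of_ae_bound h
  have h2 : eLpNorm g ∞ μ ≠ ∞ := ne_top_of_le_ne_top ENNReal.ofReal_ne_top h1
  rw [eLpNorm_exponent_top] at h2 ⊢
  filter_upwards [ae_le_eLpNormEssSup (f := g) (μ := μ)] with t ht
  have := ENNReal.toReal_mono h2 ht
  rwa [toReal_enorm] at this

theorem toReal_essSup_le {F : Type*} [NormedAddCommGroup F] {μ : Measure ℝ} {g : ℝ → F}
    {C : ℝ} (hC : 0 ≤ C) (h : ∀ᵐ t ∂μ, ‖g t‖ ≤ C) : (eLpNorm g ∞ μ).toReal ≤ C := by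
  refine ENNReal.toReal_le_of_le_ofReal hC ?_
  rw [eLpNorm_exponent_top]
  exact eLpNormEssSup_le_of_ae_bound h

end Bolza

namespace BolzaProblem

open Bolza

variable {T : ℝ} {n m k : ℕ} {P : BolzaProblem n m k}

theorem LinKKT.smul (hT : 0 < T) (hP : P.IsC2 T) {z d : PD T n m k} {r : Res T n m k}
    (h : P.LinKKT z d r) (c : ℝ) : P.LinKKT z (c • d) (c • r) := by
  rw [linKKT_iff hT hP] at h ⊢
  refine ⟨?_, ?_⟩
  · filter_upwards [h.1, PD.ae_tr_smul c d, PD.ae_dot_smul c d, Res.ae_tr_smul c r]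
      with t h1 h2 h3 h4
    rw [h2, h3, h4, map_smul, ← smul_sub, h1]
  · rw [PD.bd_smul hT, map_smul, h.2]; rfl

/-- The linearized system is solvable for all right-hand sides: the localization in the definition
of strong regularity is removed by homogeneity. -/
theorem StronglyRegular.exists_linKKT (hT : 0 < T) (hP : P.IsC2 T) {z : PD T n m k}
    (h : P.StronglyRegular z) (r : Res T n m k) : ∃ d, P.LinKKT z d r := by
  obtain ⟨κ, a, c, hκ, ha, hc, h1, -⟩ := h
  have hr := r.nrm_nonneg
  set s : ℝ := c / (r.nrm + 1) with hs
  have hs0 : 0 < s := by positivity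
  have hsr : (s • r).nrm ≤ c := by
    rw [Res.nrm_smul hs0.le, hs, div_mul_eq_mul_div, div_le_iff₀ (by positivity)]
    nlinarith
  obtain ⟨d, ⟨-, hd⟩, -⟩ := h1 _ hsr
  refine ⟨s⁻¹ • d, ?_⟩
  have := hd.smul hT hP s⁻¹
  rwa [smul_smul, inv_mul_cancel₀ hs0.ne', one_smul] at this

/-- The infimum defining `C_geo` is attained: `C_geo` is itself a bound for `DF(z)⁻¹`. -/
theorem StronglyRegular.norm_le_Cgeo (hT : 0 < T) (hP : P.IsC2 T) {z : PD T n m k}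
    (h : P.StronglyRegular z) {d : PD T n m k} {r : Res T n m k} (hd : P.LinKKT z d r) :
    ‖d‖ ≤ P.Cgeo z * r.nrm := by
  refine (PD.norm_le_nrm d).trans ?_
  -- The local Lipschitz constant is a global bound, by scaling `d` and `r` into the localization.
  have hne : {C : ℝ | 0 ≤ C ∧ ∀ (d : PD T n m k) (r : Res T n m k), P.LinKKT z d r →
      d.nrm ≤ C * r.nrm}.Nonempty := by
    obtain ⟨κ, a, c, hκ, ha, hc, -, h2⟩ := h
    refine ⟨κ, hκ, fun d r hd => ?_⟩
    have hr := r.nrm_nonneg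
    have hd0 : 0 ≤ d.nrm := Real.sqrt_nonneg _
    set s : ℝ := min (c / (r.nrm + 1)) (a / (d.nrm + 1)) with hs
    have hs0 : 0 < s := lt_min (by positivity) (by positivity)
    have hsr : (s • r).nrm ≤ c := by
      rw [Res.nrm_smul hs0.le]
      have : s * (r.nrm + 1) ≤ c := (le_div_iff₀ (by positivity)).1 (min_le_left _ _)
      nlinarith
    have hsd : (s • d).nrm ≤ a := by
      rw [PD.nrm_smul hT hs0.le]
      have : s * (d.nrm + 1) ≤ a := (le_div_iff₀ (by positivity)).1 (min_le_right _ _)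
      nlinarith
    have hz := h2 (s • r) ((0 : ℝ) • r) (s • d) ((0 : ℝ) • d) hsr
      (by rw [Res.nrm_smul le_rfl]; linarith) hsd
      (by rw [PD.nrm_smul hT le_rfl]; linarith) (hd.smul hT hP s) (hd.smul hT hP 0)
    rw [zero_smul, zero_smul, sub_zero, sub_zero, PD.nrm_smul hT hs0.le, Res.nrm_smul hs0.le] at hz
    exact le_of_mul_le_mul_left (by linarith) hs0
  rcases r.nrm_nonneg.eq_or_lt with hr | hr
  · obtain ⟨C, -, hC⟩ := hne
    have := hC d r hd
    rw [← hr] at this ⊢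
    simpa using this
  · rw [← div_le_iff₀ hr]
    exact le_csInf hne fun C hC => (div_le_iff₀ hr).2 (hC.2 d r hd)

theorem Cgeo_nonneg (z : PD T n m k) : 0 ≤ P.Cgeo z := Real.sInf_nonneg fun _ h => h.1

theorem ae_norm_tr_le_of_boundedBy {z : PD T n m k} {M : ℝ} (hM : z.BoundedBy M) :
    ∀ᵐ t ∂(timeMeasure T), ‖z.tr t‖ ≤ M := by
  filter_upwards [ae_restrict_mem measurableSet_Icc, hM.2.1] with t ht hu
  exact max_le (hM.1 t ht) (max_le hu (hM.2.2.1 t ht))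

theorem norm_bd_le_of_boundedBy (hT : 0 < T) {z : PD T n m k} {M : ℝ} (hM : z.BoundedBy M) :
    ‖z.bd‖ ≤ M := by
  have h0 : (0 : ℝ) ∈ Icc 0 T := ⟨le_rfl, hT.le⟩
  have h1 : T ∈ Icc 0 T := ⟨hT.le, le_rfl⟩
  exact max_le (hM.1 0 h0) (max_le (hM.1 T h1) (max_le (hM.2.2.1 0 h0) (max_le (hM.2.2.1 T h1)
    hM.2.2.2)))

theorem aestronglyMeasurable_fieldDeriv_apply (hT : 0 < T) (hP : P.IsC2 T) (z : PD T n m k)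
    {w : ℝ → E n × E m × E n} (hw : AEStronglyMeasurable w (timeMeasure T)) :
    AEStronglyMeasurable (fun t => P.fieldDeriv z t (w t)) (timeMeasure T) := by
  have hc : ContinuousOn (fun y : ℝ × (E n × E m × E n) =>
      fderiv ℝ (fun q => P.field (y.1, q)) y.2)
      (Icc 0 T ×ˢ univ) :=
    (contDiffOn_fderiv_slice (j := 0) hT (by simpa using contDiffOn_field hT hP)).continuousOn
  have hc2 : ContinuousOn (fun y : ℝ × (E n × E m × E n) × (E n × E m × E n) =>
      fderiv ℝ (fun q => P.field (y.1, q)) y.2.1 y.2.2) (Icc 0 T ×ˢ univ) :=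
    (hc.comp (f := fun y : ℝ × (E n × E m × E n) × (E n × E m × E n) => (y.1, y.2.1))
      (by fun_prop) (fun y hy => ⟨hy.1, mem_univ _⟩)).clm_apply (by fun_prop)
  exact aestronglyMeasurable_superposition hT hc2 (z.aestronglyMeasurable_tr.prodMk hw)

theorem aestronglyMeasurable_field (hT : 0 < T) (hP : P.IsC2 T) (z : PD T n m k) :
    AEStronglyMeasurable (fun t => P.field (t, z.tr t)) (timeMeasure T) :=
  aestronglyMeasurable_superposition hT (contDiffOn_field hT hP).continuousOn
    z.aestronglyMeasurable_tr

/-- Where the derivative of the field is essentially bounded, the linearized KKT map is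
defined on the whole space. -/
theorem exists_image (hT : 0 < T) (hP : P.IsC2 T) {z : PD T n m k} {C : ℝ}
    (hC : ∀ᵐ t ∂(timeMeasure T), ‖P.fieldDeriv z t‖ ≤ C) (d : PD T n m k) :
    ∃ r, P.LinKKT z d r := by
  have h1 : MemLp (fun t => P.fieldDeriv z t (d.tr t)) 2 (timeMeasure T) := by
    refine (d.memLp_tr hT).of_le_mul (c := C)
      (aestronglyMeasurable_fieldDeriv_apply hT hP z d.aestronglyMeasurable_tr) ?_
    filter_upwards [hC] with t ht
    exact (ContinuousLinearMap.le_opNorm _ _).trans (by gcongr)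
  obtain ⟨r, hr, hb⟩ := exists_res (d.memLp_dot.sub h1) (fderiv ℝ P.bdry z.bd d.bd)
  refine ⟨r, (linKKT_iff hT hP z d r).2 ⟨?_, hb.symm⟩⟩
  filter_upwards [hr] with t ht
  rw [ht]; rfl

/-- Quantitative form of strong regularity: a pointwise bound on `DF(z) d` bounds `d`. -/
theorem StronglyRegular.norm_le (hT : 0 < T) (hP : P.IsC2 T) {z : PD T n m k} {C : ℝ}
    (hC : ∀ᵐ t ∂(timeMeasure T), ‖P.fieldDeriv z t‖ ≤ C) (h : P.StronglyRegular z)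
    (d : PD T n m k) (w : L2 T m) {c η b : ℝ} (hc : 0 ≤ c) (hη : 0 ≤ η)
    (hd : ∀ᵐ t ∂(timeMeasure T), ‖d.dot t - P.fieldDeriv z t (d.tr t)‖ ≤ c + η * ‖w t‖)
    (hb : ‖fderiv ℝ P.bdry z.bd d.bd‖ ≤ b) :
    ‖d‖ ≤ P.Cgeo z * (3 * (Real.sqrt T * c + η * ‖w‖) + 3 * b) := by
  obtain ⟨r, hr⟩ := exists_image hT hP hC d
  have hr' := (linKKT_iff hT hP z d r).1 hr
  refine (h.norm_le_Cgeo hT hP hr).trans (mul_le_mul_of_nonneg_left ?_ (Cgeo_nonneg z))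
  refine r.nrm_le hT w hc hη ?_ (by rwa [← hr'.2])
  filter_upwards [hr'.1, hd] with t h1 h2
  rwa [← h1]

end BolzaProblem

/-! ### Simplified Newton steps in uniform balls -/

namespace Bolza

variable {T : ℝ} {n m k : ℕ}

/-- The points of the primal-dual space at uniform distance at most `δ` from `w`, in the state, the
control (essentially), the costate and the multiplier separately. -/
def PD.supBall (w : PD T n m k) (δ : ℝ) : Set (PD T n m k) :=
  {z | (∀ t ∈ Icc (0 : ℝ) T, ‖z.x t - w.x t‖ ≤ δ) ∧
    (∀ᵐ t ∂(timeMeasure T), ‖z.u t - w.u t‖ ≤ δ) ∧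
    (∀ t ∈ Icc (0 : ℝ) T, ‖z.p t - w.p t‖ ≤ δ) ∧ ‖z.lam - w.lam‖ ≤ δ}

namespace PD

theorem mem_supBall_self (w : PD T n m k) {δ : ℝ} (hδ : 0 ≤ δ) : w ∈ w.supBall δ := by
  refine ⟨fun t _ => ?_, Filter.Eventually.of_forall fun t => ?_, fun t _ => ?_, ?_⟩ <;>
    simpa using hδ

theorem supBall_mono (w : PD T n m k) {δ δ' : ℝ} (h : δ ≤ δ') : w.supBall δ ⊆ w.supBall δ' :=
  fun _ hz => ⟨fun t ht => (hz.1 t ht).trans h, hz.2.1.mono fun _ ht => ht.trans h,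
    fun t ht => (hz.2.2.1 t ht).trans h, hz.2.2.2.trans h⟩

/-- Uniform balls are closed for the (weaker) topology of the primal-dual space. -/
theorem isClosed_supBall (hT : 0 < T) (w : PD T n m k) (δ : ℝ) : IsClosed (w.supBall δ) := by
  have h1 : IsClosed {z : PD T n m k | ∀ t ∈ Icc (0 : ℝ) T, ‖z.x t - w.x t‖ ≤ δ} := by
    simp only [ofPred_forall]
    refine isClosed_iInter fun t => isClosed_iInter fun ht => ?_
    have : Continuous fun z : PD T n m k => z.x t :=
      (Arc.continuous_eval hT ht).comp continuous_fst
    exact isClosed_le (by fun_prop) continuous_const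
  have h2 : IsClosed {z : PD T n m k | ∀ t ∈ Icc (0 : ℝ) T, ‖z.p t - w.p t‖ ≤ δ} := by
    simp only [ofPred_forall]
    refine isClosed_iInter fun t => isClosed_iInter fun ht => ?_
    have : Continuous fun z : PD T n m k => z.p t :=
      (Arc.continuous_eval hT ht).comp (f := fun z : PD T n m k => z.2.2.1) (by fun_prop)
    exact isClosed_le (by fun_prop) continuous_const
  have h3 : IsClosed {z : PD T n m k | ∀ᵐ t ∂(timeMeasure T), ‖z.u t - w.u t‖ ≤ δ} :=
    (isClosed_essBall w.u δ).preimage (f := fun z : PD T n m k => z.2.1) (by fun_prop)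
  have h4 : IsClosed {z : PD T n m k | ‖z.lam - w.lam‖ ≤ δ} := by
    have : Continuous fun z : PD T n m k => z.lam :=
      (continuous_snd.comp (continuous_snd.comp continuous_snd))
    exact isClosed_le (by fun_prop) continuous_const
  exact h1.inter (h3.inter (h2.inter h4))

theorem ae_norm_tr_sub_le {z w : PD T n m k} {δ : ℝ} (hz : z ∈ w.supBall δ) :
    ∀ᵐ t ∂(timeMeasure T), ‖z.tr t - w.tr t‖ ≤ δ := by
  filter_upwards [ae_restrict_mem measurableSet_Icc, hz.2.1] with t ht hu
  exact max_le (hz.1 t ht) (max_le hu (hz.2.2.1 t ht))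

theorem norm_bd_sub_le (hT : 0 < T) {z w : PD T n m k} {δ : ℝ} (hz : z ∈ w.supBall δ) :
    ‖z.bd - w.bd‖ ≤ δ := by
  have h0 : (0 : ℝ) ∈ Icc 0 T := ⟨le_rfl, hT.le⟩
  have h1 : T ∈ Icc 0 T := ⟨hT.le, le_rfl⟩
  exact max_le (hz.1 0 h0) (max_le (hz.1 T h1) (max_le (hz.2.2.1 0 h0) (max_le (hz.2.2.1 T h1)
    hz.2.2.2)))

end PD

end Bolza

namespace BolzaProblem

open Bolza

variable {T : ℝ} {n m k : ℕ} {P : BolzaProblem n m k}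

/-- Quantitative linear approximation of the KKT mapping near `z`: its derivative at `z` is bounded
by `C`, it approximates increments within uniform distance `δ` of `z` up to the factor `η`, and the
residual at `z` is at most `e`. -/
structure LinearApprox (P : BolzaProblem n m k) (z : PD T n m k) (C η δ e : ℝ) : Prop where
  deriv_le : ∀ᵐ t ∂(timeMeasure T), ‖P.fieldDeriv z t‖ ≤ C
  bdryDeriv_le : ‖fderiv ℝ P.bdry z.bd‖ ≤ C
  field : ∀ᵐ t ∂(timeMeasure T), ∀ q q', ‖q - z.tr t‖ ≤ δ → ‖q' - z.tr t‖ ≤ δ →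
    ‖P.field (t, q) - P.field (t, q') - P.fieldDeriv z t (q - q')‖ ≤ η * ‖q - q'‖
  bdry : ∀ y y', ‖y - z.bd‖ ≤ δ → ‖y' - z.bd‖ ≤ δ →
    ‖P.bdry y - P.bdry y' - fderiv ℝ P.bdry z.bd (y - y')‖ ≤ η * ‖y - y'‖
  bdryDeriv : ∀ y, ‖y - z.bd‖ ≤ δ → ‖fderiv ℝ P.bdry y - fderiv ℝ P.bdry z.bd‖ ≤ η
  res : ∀ᵐ t ∂(timeMeasure T), ‖z.dot t - P.field (t, z.tr t)‖ ≤ e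
  bdryRes : ‖P.bdry z.bd‖ ≤ e

/-- `w` is obtained from `z` by a simplified Newton step, `F(z) + DF(zN)(w - z) = 0`. -/
def IsNewtonStep (P : BolzaProblem n m k) (zN z w : PD T n m k) : Prop :=
  (∀ᵐ t ∂(timeMeasure T),
    w.dot t = P.field (t, z.tr t) + P.fieldDeriv zN t (w.tr t - z.tr t)) ∧
  P.bdry z.bd + fderiv ℝ P.bdry zN.bd (w.bd - z.bd) = 0

/-- KKT points are the fixed points of the simplified Newton iteration. -/
theorem isNewtonStep_self_iff (zN z : PD T n m k) : P.IsNewtonStep zN z z ↔ P.IsKKT z := by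
  simp [IsNewtonStep, isKKT_iff]

theorem LinearApprox.exists_isNewtonStep (hT : 0 < T) (hP : P.IsC2 T) {zN : PD T n m k}
    {C η δ e : ℝ} (h : P.LinearApprox zN C η δ e) (hreg : P.StronglyRegular zN)
    {z : PD T n m k} (hη : 0 ≤ η) (hδ : 0 ≤ δ) (hz : z ∈ zN.supBall δ) :
    ∃ w, P.IsNewtonStep zN z w := by
  have hm : AEStronglyMeasurable (fun t => P.field (t, z.tr t) - P.field (t, zN.tr t)
      - P.fieldDeriv zN t (z.tr t - zN.tr t)) (timeMeasure T) :=
    ((aestronglyMeasurable_field hT hP z).sub (aestronglyMeasurable_field hT hP zN)).sub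
      (aestronglyMeasurable_fieldDeriv_apply hT hP zN
        (z.aestronglyMeasurable_tr.sub zN.aestronglyMeasurable_tr))
  have h1 : MemLp (fun t => P.field (t, z.tr t) - P.field (t, zN.tr t)
      - P.fieldDeriv zN t (z.tr t - zN.tr t)) 2 (timeMeasure T) := by
    refine MemLp.of_bound hm (η * δ) ?_
    filter_upwards [h.field, PD.ae_norm_tr_sub_le hz] with t h2 h3
    exact (h2 _ _ h3 (by simpa using hδ)).trans (by gcongr)
  have h2 : MemLp (fun t => P.field (t, zN.tr t) - zN.dot t) 2 (timeMeasure T) := by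
    refine MemLp.of_bound ((aestronglyMeasurable_field hT hP zN).sub
      zN.memLp_dot.aestronglyMeasurable) e ?_
    filter_upwards [h.res] with t ht
    rwa [norm_sub_rev]
  obtain ⟨r, hr, hrb⟩ := exists_res (h1.add h2)
    (fderiv ℝ P.bdry zN.bd (z.bd - zN.bd) - P.bdry z.bd)
  obtain ⟨d, hd⟩ := hreg.exists_linKKT hT hP r
  rw [linKKT_iff hT hP] at hd
  set w := d + zN with hw
  have hdw : d = w - zN := by simp [hw]
  rw [hdw] at hd
  refine ⟨w, ?_, ?_⟩
  · filter_upwards [hd.1, hr, PD.ae_tr_sub w zN, PD.ae_dot_sub w zN] with t a1 a2 a3 a4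
    rw [a2, a3, a4, Pi.add_apply, sub_eq_iff_eq_add, sub_eq_iff_eq_add] at a1
    rw [a1]
    simp only [map_sub]
    abel
  · have h3 := hd.2
    rw [hrb, PD.bd_sub hT] at h3
    rw [← sub_sub_sub_cancel_right w.bd z.bd zN.bd, map_sub, h3]
    abel

/-- The residual of a Newton step, seen from the center `zN`. -/
theorem LinearApprox.norm_step_le (hT : 0 < T) {zN : PD T n m k}
    {C η δ e τ : ℝ} (h : P.LinearApprox zN C η δ e) (hη : 0 ≤ η) (hτ : 0 ≤ τ) (hτδ : τ ≤ δ)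
    {z w : PD T n m k} (hz : z ∈ zN.supBall τ) (hw : P.IsNewtonStep zN z w) :
    (∀ᵐ t ∂(timeMeasure T),
      ‖(w - zN).dot t - P.fieldDeriv zN t ((w - zN).tr t)‖ ≤ e + η * τ) ∧
    ‖fderiv ℝ P.bdry zN.bd (w - zN).bd‖ ≤ e + η * τ := by
  have hδ : 0 ≤ δ := hτ.trans hτδ
  refine ⟨?_, ?_⟩
  · filter_upwards [hw.1, PD.ae_tr_sub w zN, PD.ae_dot_sub w zN, h.field, h.res,
      PD.ae_norm_tr_sub_le hz] with t a1 a2 a3 a4 a5 a6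
    have h1 := a4 (z.tr t) (zN.tr t) (a6.trans hτδ) (by simpa using hδ)
    have h2 : (w - zN).dot t - P.fieldDeriv zN t ((w - zN).tr t)
        = (P.field (t, z.tr t) - P.field (t, zN.tr t) - P.fieldDeriv zN t (z.tr t - zN.tr t))
          - (zN.dot t - P.field (t, zN.tr t)) := by
      rw [a2, a3, a1]
      simp only [map_sub]
      abel
    rw [h2]
    have h3 : η * ‖z.tr t - zN.tr t‖ ≤ η * τ := by gcongr
    exact (norm_sub_le _ _).trans (by linarith)
  · have a6 := PD.norm_bd_sub_le hT hz
    have h1 := h.bdry z.bd zN.bd (a6.trans hτδ) (by simpa using hδ)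
    have h2 : fderiv ℝ P.bdry zN.bd (w - zN).bd
        = -(P.bdry z.bd - P.bdry zN.bd - fderiv ℝ P.bdry zN.bd (z.bd - zN.bd))
          - P.bdry zN.bd := by
      have h3 := eq_neg_of_add_eq_zero_right hw.2
      rw [PD.bd_sub hT, ← sub_add_sub_cancel w.bd z.bd zN.bd, map_add, h3]
      abel
    rw [h2]
    have h3 : η * ‖z.bd - zN.bd‖ ≤ η * τ := by gcongr
    have h4 := norm_sub_le (-(P.bdry z.bd - P.bdry zN.bd
      - fderiv ℝ P.bdry zN.bd (z.bd - zN.bd))) (P.bdry zN.bd)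
    rw [norm_neg] at h4
    have h5 := h.bdryRes
    linarith

/-- The simplified Newton map is Lipschitz in the Hilbert norm on the uniform ball: the
linearization error is controlled pointwise, and `DF(zN)⁻¹` is bounded in the Hilbert norm. -/
theorem LinearApprox.norm_step_sub_le (hT : 0 < T) (hP : P.IsC2 T) {zN : PD T n m k}
    {C η δ e : ℝ} (h : P.LinearApprox zN C η δ e) (hreg : P.StronglyRegular zN) (hη : 0 ≤ η)
    {z w z' w' : PD T n m k} (hz : z ∈ zN.supBall δ) (hw : P.IsNewtonStep zN z w)
    (hz' : z' ∈ zN.supBall δ) (hw' : P.IsNewtonStep zN z' w') :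
    ‖w - w'‖ ≤ P.Cgeo zN * (9 * (1 + Real.sqrt T) ^ 2 * η) * ‖z - z'‖ := by
  have h1 : ∀ᵐ t ∂(timeMeasure T), ‖(w - w').dot t - P.fieldDeriv zN t ((w - w').tr t)‖
      ≤ η * ((1 + Real.sqrt T) * ‖z - z'‖) + η * ‖(z - z').u t‖ := by
    filter_upwards [hw.1, hw'.1, PD.ae_tr_sub w w', PD.ae_dot_sub w w', h.field,
      PD.ae_norm_tr_sub_le hz, PD.ae_norm_tr_sub_le hz', PD.ae_tr_sub z z',
      PD.ae_norm_tr_le hT (z - z')] with t a1 a1' a2 a3 a4 a5 a5' a6 a7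
    have h2 : (w - w').dot t - P.fieldDeriv zN t ((w - w').tr t)
        = P.field (t, z.tr t) - P.field (t, z'.tr t) - P.fieldDeriv zN t (z.tr t - z'.tr t) := by
      rw [a2, a3, a1, a1']
      simp only [map_sub]
      abel
    rw [h2, ← mul_add]
    refine (a4 _ _ a5 a5').trans ?_
    rw [← a6]
    gcongr
  have h2 : ‖fderiv ℝ P.bdry zN.bd (w - w').bd‖ ≤ η * ((1 + Real.sqrt T) * ‖z - z'‖) := by
    have a1 := h.bdry z.bd z'.bd (PD.norm_bd_sub_le hT hz) (PD.norm_bd_sub_le hT hz')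
    have a2 : fderiv ℝ P.bdry zN.bd (w - w').bd
        = -(P.bdry z.bd - P.bdry z'.bd - fderiv ℝ P.bdry zN.bd (z.bd - z'.bd)) := by
      have h3 := eq_neg_of_add_eq_zero_right hw.2
      have h4 := eq_neg_of_add_eq_zero_right hw'.2
      rw [map_sub] at h3 h4
      rw [PD.bd_sub hT, map_sub, map_sub, sub_eq_iff_eq_add.1 h3, sub_eq_iff_eq_add.1 h4]
      abel
    rw [a2, norm_neg]
    refine a1.trans ?_
    rw [← PD.bd_sub hT]
    gcongr
    exact PD.norm_bd_le hT _
  have h3 := hreg.norm_le hT hP h.deriv_le (w - w') (z - z').u (by positivity) hη h1 h2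
  refine h3.trans ?_
  rw [mul_assoc]
  refine mul_le_mul_of_nonneg_left ?_ (Cgeo_nonneg zN)
  have h4 := PD.norm_u_le (z - z')
  have h5 : η * ‖(z - z').u‖ ≤ η * ‖z - z'‖ := by gcongr
  have h6 := Real.sqrt_nonneg T
  have h7 : 0 ≤ η * ‖z - z'‖ := by positivity
  have h8 : 0 ≤ η * ‖z - z'‖ * Real.sqrt T := by positivity
  have h9 : 0 ≤ η * ‖z - z'‖ * Real.sqrt T ^ 2 := by positivity
  nlinarith

theorem ae_norm_Hux_le (hT : 0 < T) (hP : P.IsC2 T) {z : PD T n m k} {C : ℝ}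
    (hC : ∀ᵐ t ∂(timeMeasure T), ‖P.fieldDeriv z t‖ ≤ C) :
    ∀ᵐ t ∂(timeMeasure T), ‖P.Hux t (z.x t) (z.u t) (z.p t)‖ ≤ C := by
  filter_upwards [ae_restrict_mem measurableSet_Icc, hC] with t ht h
  refine ContinuousLinearMap.opNorm_le_bound _ ((norm_nonneg _).trans h) fun y => ?_
  have h1 : ‖((y, 0, 0) : E n × E m × E n)‖ = ‖y‖ := by simp [Prod.norm_def]
  rw [Hux_apply hT hP ht, norm_neg, ← h1]
  exact ((norm_snd_le _).trans (norm_snd_le _)).trans (ContinuousLinearMap.le_of_opNorm_le _ h _)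

theorem ae_norm_Hup_le (hT : 0 < T) (hP : P.IsC2 T) {z : PD T n m k} {C : ℝ}
    (hC : ∀ᵐ t ∂(timeMeasure T), ‖P.fieldDeriv z t‖ ≤ C) :
    ∀ᵐ t ∂(timeMeasure T), ‖P.Hup t (z.x t) (z.u t) (z.p t)‖ ≤ C := by
  filter_upwards [ae_restrict_mem measurableSet_Icc, hC] with t ht h
  refine ContinuousLinearMap.opNorm_le_bound _ ((norm_nonneg _).trans h) fun y => ?_
  have h1 : ‖((0, 0, y) : E n × E m × E n)‖ = ‖y‖ := by simp [Prod.norm_def]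
  rw [Hup_apply hT hP ht, norm_neg, ← h1]
  exact ((norm_snd_le _).trans (norm_snd_le _)).trans (ContinuousLinearMap.le_of_opNorm_le _ h _)

theorem ae_norm_fx_le (hT : 0 < T) (hP : P.IsC2 T) {z : PD T n m k} {C : ℝ}
    (hC : ∀ᵐ t ∂(timeMeasure T), ‖P.fieldDeriv z t‖ ≤ C) :
    ∀ᵐ t ∂(timeMeasure T), ‖fderiv ℝ (fun y => P.f t y (z.u t)) (z.x t)‖ ≤ C := by
  filter_upwards [ae_restrict_mem measurableSet_Icc, hC] with t ht h
  refine ContinuousLinearMap.opNorm_le_bound _ ((norm_nonneg _).trans h) fun y => ?_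
  have h1 : ‖((y, 0, 0) : E n × E m × E n)‖ = ‖y‖ := by simp [Prod.norm_def]
  rw [fderiv_f_left_apply hT hP ht _ _ (z.p t), ← h1]
  exact (norm_fst_le _).trans (ContinuousLinearMap.le_of_opNorm_le _ h _)

theorem ae_norm_fu_le (hT : 0 < T) (hP : P.IsC2 T) {z : PD T n m k} {C : ℝ}
    (hC : ∀ᵐ t ∂(timeMeasure T), ‖P.fieldDeriv z t‖ ≤ C) :
    ∀ᵐ t ∂(timeMeasure T), ‖fderiv ℝ (fun v => P.f t (z.x t) v) (z.u t)‖ ≤ C := by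
  filter_upwards [ae_restrict_mem measurableSet_Icc, hC] with t ht h
  refine ContinuousLinearMap.opNorm_le_bound _ ((norm_nonneg _).trans h) fun y => ?_
  have h1 : ‖((0, y, 0) : E n × E m × E n)‖ = ‖y‖ := by simp [Prod.norm_def]
  rw [fderiv_f_right_apply hT hP ht _ _ (z.p t), ← h1]
  exact (norm_fst_le _).trans (ContinuousLinearMap.le_of_opNorm_le _ h _)

/-- The strengthened Legendre condition solves the linearized stationarity condition pointwise for
the control. -/
theorem StrengthenedLegendre.norm_u_le (hT : 0 < T) (hP : P.IsC2 T) {z : PD T n m k} {ρ C : ℝ}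
    (hC : ∀ᵐ t ∂(timeMeasure T), ‖P.fieldDeriv z t‖ ≤ C)
    (hL : P.StrengthenedLegendre ρ z) (d : PD T n m k) {a : ℝ}
    (hd : ∀ᵐ t ∂(timeMeasure T), ‖d.dot t - P.fieldDeriv z t (d.tr t)‖ ≤ a) :
    ∀ᵐ t ∂(timeMeasure T), ρ * ‖d.u t‖ ≤
      a + (P.normHux z * ‖d.x t‖ + P.normHup z * ‖d.p t‖) := by
  filter_upwards [ae_restrict_mem measurableSet_Icc, hL, hd,
    ae_norm_le_toReal_essSup (ae_norm_Hux_le hT hP hC),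
    ae_norm_le_toReal_essSup (ae_norm_Hup_le hT hP hC)] with t ht h1 h2 h3 h4
  have h5 : P.Huu t (z.x t) (z.u t) (z.p t) (d.u t) = (d.dot t - P.fieldDeriv z t (d.tr t)).2.2
      - P.Hux t (z.x t) (z.u t) (z.p t) (d.x t) - P.Hup t (z.x t) (z.u t) (z.p t) (d.p t) := by
    rw [Hux_apply hT hP ht, Hup_apply hT hP ht, Huu_apply hT hP ht]
    have h6 : d.tr t = (d.x t, 0, 0) + (0, d.u t, 0) + (0, 0, d.p t) := by simp [PD.tr]
    have h7 : (d.dot t).2.2 = 0 := rfl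
    rw [h6, map_add, map_add, fieldDeriv]
    simp only [Prod.snd_sub, Prod.snd_add, h7, PD.tr]
    abel
  have h6 : ‖P.Huu t (z.x t) (z.u t) (z.p t) (d.u t)‖ ≤
      a + P.normHux z * ‖d.x t‖ + P.normHup z * ‖d.p t‖ := by
    rw [h5]
    refine (norm_sub_le _ _).trans (add_le_add ((norm_sub_le _ _).trans (add_le_add ?_ ?_)) ?_)
    · exact ((norm_snd_le _).trans (norm_snd_le _)).trans h2
    · exact (ContinuousLinearMap.le_opNorm _ _).trans (by gcongr; exact h3)
    · exact (ContinuousLinearMap.le_opNorm _ _).trans (by gcongr; exact h4)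
  rw [← add_assoc]
  refine le_trans ?_ h6
  rcases (norm_nonneg (d.u t)).eq_or_lt with h0 | h0
  · rw [← h0]; simp
  · have h7 := (h1 (d.u t)).trans (real_inner_le_norm _ _)
    refine le_of_mul_le_mul_right ?_ h0
    linarith

end BolzaProblem

/-! ### Existence of a KKT point, and control of the multiplier -/

namespace Bolza

variable {T : ℝ} {n m k : ℕ}

namespace PD

/-- The variation that changes only the algebraic variables: the control and the multiplier. -/
noncomputable def algebraic (v : L2 T m) (μ : E k) : PD T n m k := (0, v, 0, μ)

theorem ae_tr_algebraic (hT : 0 < T) (v : L2 T m) (μ : E k) :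
    ∀ᵐ t ∂(timeMeasure T), (algebraic v μ : PD T n m k).tr t = (0, v t, 0) := by
  filter_upwards [ae_restrict_mem measurableSet_Icc] with t ht
  have h : (0 : Arc T n).val t = 0 := by simpa using Arc.norm_val_le hT (0 : Arc T n) ht
  exact Prod.ext h (Prod.ext rfl h)

theorem ae_dot_algebraic (v : L2 T m) (μ : E k) :
    ∀ᵐ t ∂(timeMeasure T), (algebraic v μ : PD T n m k).dot t = 0 := by
  filter_upwards [Lp.coeFn_zero (E n) 2 (timeMeasure T)] with t ht
  refine Prod.ext ht (Prod.ext ?_ rfl)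
  change -((0 : L2 T n) t) = 0
  rw [ht, Pi.zero_apply, neg_zero]

theorem bd_algebraic (hT : 0 < T) (v : L2 T m) (μ : E k) :
    (algebraic v μ : PD T n m k).bd = (0, 0, 0, 0, μ) := by
  have h : ∀ t ∈ Icc 0 T, (0 : Arc T n).val t = 0 := fun t ht => by
    simpa using Arc.norm_val_le hT (0 : Arc T n) ht
  have h0 := h 0 ⟨le_rfl, hT.le⟩
  have h1 := h T ⟨hT.le, le_rfl⟩
  exact Prod.ext h0 (Prod.ext h1 (Prod.ext h0 (Prod.ext h1 rfl)))

theorem supDist_le {z w : PD T n m k} {a b : ℝ} (ha : 0 ≤ a) (hb : 0 ≤ b)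
    (hx : ∀ t ∈ Icc (0 : ℝ) T, ‖z.x t - w.x t‖ ≤ a)
    (hu : ∀ᵐ t ∂(timeMeasure T), ‖z.u t - w.u t‖ ≤ b)
    (hp : ∀ t ∈ Icc (0 : ℝ) T, ‖z.p t - w.p t‖ ≤ a) :
    z.supDist w ≤ ENNReal.ofReal (a + b + a) := by
  have h1 : ∀ g : ℝ → E n, (∀ t ∈ Icc (0 : ℝ) T, ‖g t‖ ≤ a) → supNorm T g ≤ ENNReal.ofReal a := by
    intro g hg
    refine iSup₂_le fun t ht => ?_
    rw [← ofReal_norm]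
    exact ENNReal.ofReal_le_ofReal (hg t ht)
  rw [ENNReal.ofReal_add (by positivity) ha, ENNReal.ofReal_add ha hb, supDist]
  refine add_le_add (add_le_add (h1 _ hx) ?_) (h1 _ hp)
  rw [eLpNorm_exponent_top]
  exact eLpNormEssSup_le_of_ae_bound hu

theorem bounds_of_supDist_le {z w : PD T n m k} {δ : ℝ} (hδ : 0 ≤ δ)
    (h : z.supDist w ≤ ENNReal.ofReal δ) :
    (∀ t ∈ Icc (0 : ℝ) T, ‖z.x t - w.x t‖ ≤ δ) ∧
    (∀ᵐ t ∂(timeMeasure T), ‖z.u t - w.u t‖ ≤ δ) ∧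
    (∀ t ∈ Icc (0 : ℝ) T, ‖z.p t - w.p t‖ ≤ δ) := by
  have h0 : ∀ {F : Type} [NormedAddCommGroup F] (y : F), ‖y‖ₑ ≤ ENNReal.ofReal δ → ‖y‖ ≤ δ := by
    intro F _ y hy
    rwa [← ofReal_norm, ENNReal.ofReal_le_ofReal_iff hδ] at hy
  have h1 : ∀ g : ℝ → E n, supNorm T g ≤ ENNReal.ofReal δ → ∀ t ∈ Icc (0 : ℝ) T, ‖g t‖ ≤ δ :=
    fun g hg t ht => h0 _ ((le_iSup₂ (f := fun t (_ : t ∈ Icc 0 T) => ‖g t‖ₑ) t ht).trans hg)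
  refine ⟨h1 _ ((le_self_add.trans le_self_add).trans h), ?_, h1 _ (le_add_self.trans h)⟩
  have h2 := (le_add_self.trans le_self_add).trans h
  rw [eLpNorm_exponent_top] at h2
  filter_upwards [ae_le_eLpNormEssSup (f := fun t => z.u t - w.u t) (μ := timeMeasure T)] with t ht
  exact h0 _ (ht.trans h2)

end PD

end Bolza

namespace BolzaProblem

open Bolza

variable {T : ℝ} {n m k : ℕ} {P : BolzaProblem n m k}

theorem ae_norm_res_le {z : PD T n m k} (hE : P.Einf z ≠ ∞) :
    (∀ᵐ t ∂(timeMeasure T), ‖z.dot t - P.field (t, z.tr t)‖ ≤ (P.Einf z).toReal) ∧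
      ‖P.bdry z.bd‖ ≤ (P.Einf z).toReal := by
  have h0 : ∀ {F : Type} [NormedAddCommGroup F] (y : F), ‖y‖ₑ ≤ P.Einf z →
      ‖y‖ ≤ (P.Einf z).toReal := by
    intro F _ y hy
    rw [← toReal_enorm]
    exact ENNReal.toReal_mono hE hy
  have h1 : eLpNormEssSup (P.F1 z) (timeMeasure T) ≤ P.Einf z := by
    rw [← eLpNorm_exponent_top]
    exact (le_self_add.trans le_self_add).trans le_self_add
  have h2 : eLpNormEssSup (P.F2 z) (timeMeasure T) ≤ P.Einf z := by
    rw [← eLpNorm_exponent_top]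
    exact (le_add_self.trans le_self_add).trans le_self_add
  have h3 : eLpNormEssSup (P.F3 z) (timeMeasure T) ≤ P.Einf z := by
    rw [← eLpNorm_exponent_top]
    exact le_add_self.trans le_self_add
  refine ⟨?_, max_le (h0 _ ?_) (max_le (h0 _ ?_) (h0 _ ?_))⟩
  · filter_upwards [ae_le_eLpNormEssSup (f := P.F1 z) (μ := timeMeasure T),
      ae_le_eLpNormEssSup (f := P.F2 z) (μ := timeMeasure T),
      ae_le_eLpNormEssSup (f := P.F3 z) (μ := timeMeasure T)] with t a1 a2 a3
    have h4 : z.dot t - P.field (t, z.tr t) = (P.F1 z t, P.F2 z t, P.F3 z t) :=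
      Prod.ext rfl (Prod.ext rfl (by simp [PD.dot, field, F3, PD.tr]))
    rw [h4]
    exact max_le (h0 _ (a1.trans h1)) (max_le (h0 _ (a2.trans h2)) (h0 _ (a3.trans h3)))
  · exact (le_self_add.trans le_self_add).trans
      (le_add_self (a := ‖P.F4 z‖ₑ + ‖P.F5 z‖ₑ + ‖P.F6 z‖ₑ))
  · exact (le_add_self.trans le_self_add).trans
      (le_add_self (a := ‖P.F4 z‖ₑ + ‖P.F5 z‖ₑ + ‖P.F6 z‖ₑ))
  · exact le_add_self.trans (le_add_self (a := ‖P.F4 z‖ₑ + ‖P.F5 z‖ₑ + ‖P.F6 z‖ₑ))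

theorem exists_const_L2 (hT : 0 < T) (y : E m) :
    ∃ v : L2 T m, (∀ᵐ t ∂(timeMeasure T), v t = y) ∧ ‖v‖ = Real.sqrt T * ‖y‖ := by
  refine ⟨Lp.const 2 (timeMeasure T) y, Lp.coeFn_const (p := 2) (μ := timeMeasure T) y, ?_⟩
  rw [Lp.norm_const' 2 (timeMeasure T) y two_ne_zero ENNReal.ofNat_ne_top,
    timeMeasure_real_univ hT, Real.sqrt_eq_rpow, mul_comm]
  norm_num

/-- Where there are controls, `C_geo` is bounded below: a constant variation of the control has an
image under `DF(z)` of comparable size. -/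
theorem StronglyRegular.norm_le_Cgeo_mul (hT : 0 < T) (hP : P.IsC2 T) {z : PD T n m k} {C : ℝ}
    (hC : ∀ᵐ t ∂(timeMeasure T), ‖P.fieldDeriv z t‖ ≤ C) (hC0 : 0 ≤ C)
    (hreg : P.StronglyRegular z) (y : E m) : ‖y‖ ≤ 3 * C * P.Cgeo z * ‖y‖ := by
  obtain ⟨v, hv, hvn⟩ := exists_const_L2 hT y
  have hd : ∀ᵐ t ∂(timeMeasure T), ‖(PD.algebraic v 0 : PD T n m k).dot t
      - P.fieldDeriv z t ((PD.algebraic v 0 : PD T n m k).tr t)‖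
        ≤ C * ‖y‖ + 0 * ‖(0 : L2 T m) t‖ := by
    filter_upwards [hC, PD.ae_tr_algebraic (n := n) hT v (0 : E k),
      PD.ae_dot_algebraic (n := n) v (0 : E k), hv] with t a1 a2 a3 a4
    rw [a2, a3, zero_sub, norm_neg, zero_mul, add_zero, a4]
    have h5 : ‖((0, y, 0) : E n × E m × E n)‖ = ‖y‖ := by simp [Prod.norm_def]
    rw [← h5]
    exact ContinuousLinearMap.le_of_opNorm_le _ a1 _
  have hb : ‖fderiv ℝ P.bdry z.bd (PD.algebraic v 0 : PD T n m k).bd‖ ≤ 0 := by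
    have h5 : (PD.algebraic v 0 : PD T n m k).bd = 0 := PD.bd_algebraic hT v 0
    rw [h5, map_zero, norm_zero]
  have h1 := hreg.norm_le hT hP hC (PD.algebraic v 0) 0 (by positivity) le_rfl hd hb
  have h2 : ‖v‖ ≤ ‖(PD.algebraic v 0 : PD T n m k)‖ := PD.norm_u_le (PD.algebraic v 0)
  have h3 : 0 < Real.sqrt T := Real.sqrt_pos.2 hT
  rw [hvn] at h2
  refine le_of_mul_le_mul_left ?_ h3
  refine (h2.trans h1).trans (le_of_eq ?_)
  ring

/-- Uniform closeness of the states and costates forces closeness of the multipliers of KKT points: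
the boundary conditions are affine in the multiplier, with an injective linear part whose inverse is
controlled by `C_geo`. -/
theorem LinearApprox.norm_lam_sub_le (hT : 0 < T) (hP : P.IsC2 T) {zN : PD T n m k}
    {C η δ e : ℝ} (h : P.LinearApprox zN C η δ e) (hreg : P.StronglyRegular zN)
    {z : PD T n m k} {δ' : ℝ} (hδ' : 0 ≤ δ') (hδ : δ' ≤ δ) (hη : 0 ≤ η) (hz : P.IsKKT z)
    (hx : ∀ t ∈ Icc (0 : ℝ) T, ‖z.x t - zN.x t‖ ≤ δ')
    (hp : ∀ t ∈ Icc (0 : ℝ) T, ‖z.p t - zN.p t‖ ≤ δ') :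
    ‖z.lam - zN.lam‖ ≤ 3 * P.Cgeo zN * (e + (C + η) * δ' + η * ‖z.lam - zN.lam‖) := by
  have h0 : (0 : ℝ) ∈ Icc 0 T := ⟨le_rfl, hT.le⟩
  have h1 : T ∈ Icc 0 T := ⟨hT.le, le_rfl⟩
  set μ := z.lam - zN.lam with hμ
  set y : E n × E n × E n × E n × E k := (z.x 0, z.x T, z.p 0, z.p T, zN.lam) with hy
  have hyd : ‖y - zN.bd‖ ≤ δ' := by
    refine max_le (hx 0 h0) (max_le (hx T h1) (max_le (hp 0 h0) (max_le (hp T h1) ?_)))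
    simpa [hy, PD.bd] using hδ'
  have hzy : z.bd = (z.x 0, z.x T, z.p 0, z.p T, zN.lam + μ) := by simp [hμ, PD.bd]
  have h2 : fderiv ℝ P.bdry y (0, 0, 0, 0, μ) = -P.bdry y := by
    have := fderiv_bdry_lam hP (z.x 0) (z.x T) (z.p 0) (z.p T) zN.lam μ
    rw [← hzy, ((isKKT_iff z).1 hz).2, zero_sub] at this
    exact this
  have h3 : ‖P.bdry y‖ ≤ e + (C + η) * δ' := by
    have a1 := h.bdry y zN.bd (hyd.trans hδ) (by simpa using hδ'.trans hδ)
    have a2 : P.bdry y = (P.bdry y - P.bdry zN.bd - fderiv ℝ P.bdry zN.bd (y - zN.bd))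
      + fderiv ℝ P.bdry zN.bd (y - zN.bd) + P.bdry zN.bd := by abel
    have a3 : ‖fderiv ℝ P.bdry zN.bd (y - zN.bd)‖ ≤ C * δ' :=
      ContinuousLinearMap.le_of_opNorm_le_of_le _ h.bdryDeriv_le hyd
    have a4 : η * ‖y - zN.bd‖ ≤ η * δ' := by gcongr
    rw [a2]
    refine norm_add₃_le.trans ?_
    have := h.bdryRes
    linarith
  have hμn : ‖((0, 0, 0, 0, μ) : E n × E n × E n × E n × E k)‖ = ‖μ‖ := by simp [Prod.norm_def]
  have h4 : ‖fderiv ℝ P.bdry zN.bd (0, 0, 0, 0, μ)‖ ≤ e + (C + η) * δ' + η * ‖μ‖ := by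
    have a1 : fderiv ℝ P.bdry zN.bd (0, 0, 0, 0, μ) = -P.bdry y
        - (fderiv ℝ P.bdry y - fderiv ℝ P.bdry zN.bd) (0, 0, 0, 0, μ) := by
      rw [sub_apply, h2]; abel
    have a2 := ContinuousLinearMap.le_of_opNorm_le _ (h.bdryDeriv y (hyd.trans hδ))
      ((0, 0, 0, 0, μ) : E n × E n × E n × E n × E k)
    rw [hμn] at a2
    rw [a1]
    refine (norm_sub_le _ _).trans (add_le_add ?_ a2)
    rwa [norm_neg]
  have h5 := hreg.norm_le hT hP h.deriv_le (PD.algebraic 0 μ) 0 (c := 0) le_rfl le_rfl (by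
      filter_upwards [PD.ae_tr_algebraic (n := n) hT (0 : L2 T m) μ,
        PD.ae_dot_algebraic (n := n) (0 : L2 T m) μ,
        Lp.coeFn_zero (E m) 2 (timeMeasure T)] with t a2 a3 a4
      rw [a2, a3, a4, Pi.zero_apply]
      change ‖0 - P.fieldDeriv zN t 0‖ ≤ _
      rw [map_zero, sub_zero, norm_zero, zero_mul, add_zero])
    (b := e + (C + η) * δ' + η * ‖μ‖) (by rwa [PD.bd_algebraic hT])
  refine (PD.norm_lam_le (PD.algebraic 0 μ : PD T n m k)).trans (h5.trans (le_of_eq ?_))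
  ring

/-- Bounds on a Newton step started in the uniform ball of radius `τ`, relative to its center. -/
theorem LinearApprox.step_bounds (hT : 0 < T) (hP : P.IsC2 T) {zN : PD T n m k}
    {C η δ e τ ρ : ℝ} (h : P.LinearApprox zN C η δ e) (hreg : P.StronglyRegular zN)
    (hL : P.StrengthenedLegendre ρ zN) (he : 0 ≤ e) (hη : 0 ≤ η) (hτ : 0 ≤ τ) (hτδ : τ ≤ δ)
    {z w : PD T n m k} (hz : z ∈ zN.supBall τ) (hw : P.IsNewtonStep zN z w) {B : ℝ}
    (hB : B = 3 * (1 + Real.sqrt T) ^ 2 * P.Cgeo zN * (e + η * τ)) :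
    (∀ t ∈ Icc (0 : ℝ) T, ‖w.x t - zN.x t‖ ≤ B) ∧
    (∀ᵐ t ∂(timeMeasure T), ρ * ‖w.u t - zN.u t‖ ≤
      (e + η * τ) + (P.normHux zN + P.normHup zN) * B) ∧
    (∀ t ∈ Icc (0 : ℝ) T, ‖w.p t - zN.p t‖ ≤ B) ∧ ‖w.lam - zN.lam‖ ≤ B := by
  obtain ⟨h1, h2⟩ := h.norm_step_le hT hη hτ hτδ hz hw
  have ha : 0 ≤ e + η * τ := by positivity
  have hs : 0 ≤ Real.sqrt T := Real.sqrt_nonneg T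
  have hC := Cgeo_nonneg (P := P) zN
  have h3 := hreg.norm_le hT hP h.deriv_le (w - zN) 0 ha le_rfl (by simpa using h1) h2
  have h4 : (1 + Real.sqrt T) * ‖w - zN‖ ≤ B := by
    rw [hB]
    refine (mul_le_mul_of_nonneg_left h3 (by positivity)).trans (le_of_eq ?_)
    ring
  have hx : ∀ t ∈ Icc (0 : ℝ) T, ‖(w - zN).x t‖ ≤ B := fun t ht => (PD.norm_x_le hT _ ht).trans h4
  have hp : ∀ t ∈ Icc (0 : ℝ) T, ‖(w - zN).p t‖ ≤ B := fun t ht => (PD.norm_p_le hT _ ht).trans h4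
  refine ⟨fun t ht => ?_, ?_, fun t ht => ?_, ?_⟩
  · rw [← PD.x_sub _ _ ht]; exact hx t ht
  · filter_upwards [hL.norm_u_le hT hP h.deriv_le (w - zN) h1, PD.ae_u_sub w zN,
      ae_restrict_mem measurableSet_Icc] with t a1 a2 ht
    rw [← a2, add_mul]
    refine a1.trans ?_
    have b1 : 0 ≤ P.normHux zN := ENNReal.toReal_nonneg
    have b2 : 0 ≤ P.normHup zN := ENNReal.toReal_nonneg
    have b3 := hx t ht
    have b4 := hp t ht
    gcongr
  · rw [← PD.p_sub _ _ ht]; exact hp t ht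
  · refine ((PD.norm_lam_le (w - zN)).trans ?_).trans h4
    exact le_mul_of_one_le_left (norm_nonneg _) (by linarith)

/-- Existence of a KKT point by the contraction principle, in a ball that is complete for the
Hilbert norm and that the simplified Newton map leaves invariant. -/
theorem LinearApprox.exists_isKKT (hT : 0 < T) (hP : P.IsC2 T) {zN : PD T n m k}
    {C η δ e τ : ℝ} (h : P.LinearApprox zN C η δ e) (hreg : P.StronglyRegular zN)
    (hη : 0 ≤ η) (hτ : 0 ≤ τ) (hτδ : τ ≤ δ)
    (hinv : ∀ z ∈ zN.supBall τ, ∀ w, P.IsNewtonStep zN z w → w ∈ zN.supBall τ)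
    (hcon : P.Cgeo zN * (9 * (1 + Real.sqrt T) ^ 2 * η) ≤ 1 / 2) :
    ∃ z ∈ zN.supBall τ, P.IsKKT z := by
  have hsub := zN.supBall_mono hτδ
  have hex : ∀ z, ∃ w, z ∈ zN.supBall τ → P.IsNewtonStep zN z w := by
    intro z
    by_cases hz : z ∈ zN.supBall τ
    · obtain ⟨w, hw⟩ := h.exists_isNewtonStep hT hP hreg hη (hτ.trans hτδ) (hsub hz)
      exact ⟨w, fun _ => hw⟩
    · exact ⟨z, fun hz' => absurd hz' hz⟩
  choose N hN using hex
  have hmaps : MapsTo N (zN.supBall τ) (zN.supBall τ) := fun z hz => hinv z hz _ (hN z hz)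
  have hK : ContractingWith (1 / 2) (hmaps.restrict N _ _) := by
    refine ⟨by rw [← NNReal.coe_lt_coe]; norm_num, LipschitzWith.of_dist_le_mul ?_⟩
    rintro ⟨z, hz⟩ ⟨z', hz'⟩
    change dist (N z) (N z') ≤ _ * dist z z'
    rw [dist_eq_norm, dist_eq_norm]
    refine (h.norm_step_sub_le hT hP hreg hη (hsub hz) (hN z hz) (hsub hz') (hN z' hz')).trans ?_
    gcongr
    simpa using hcon
  obtain ⟨z, hz, hfix, -⟩ := hK.exists_fixedPoint' (PD.isClosed_supBall hT zN τ).isComplete hmaps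
    (zN.mem_supBall_self hτ) (edist_ne_top _ _)
  refine ⟨z, hz, (isNewtonStep_self_iff zN z).1 ?_⟩
  have := hN z hz
  rwa [hfix] at this

/-- KKT points are fixed points of a contraction, hence unique in the ball. -/
theorem LinearApprox.eq_of_isKKT (hT : 0 < T) (hP : P.IsC2 T) {zN : PD T n m k}
    {C η δ e : ℝ} (h : P.LinearApprox zN C η δ e) (hreg : P.StronglyRegular zN)
    (hη : 0 ≤ η) (hcon : P.Cgeo zN * (9 * (1 + Real.sqrt T) ^ 2 * η) ≤ 1 / 2)
    {z z' : PD T n m k} (hz : z ∈ zN.supBall δ) (hz' : z' ∈ zN.supBall δ)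
    (hk : P.IsKKT z) (hk' : P.IsKKT z') : z = z' := by
  have h1 := h.norm_step_sub_le hT hP hreg hη hz ((isNewtonStep_self_iff zN z).2 hk) hz'
    ((isNewtonStep_self_iff zN z').2 hk')
  have h2 : ‖z - z'‖ ≤ 1 / 2 * ‖z - z'‖ := h1.trans (by gcongr)
  have h3 : ‖z - z'‖ = 0 := le_antisymm (by linarith) (norm_nonneg _)
  exact sub_eq_zero.1 (norm_eq_zero.1 h3)

end BolzaProblem

/-! ### Choice of constants and the proximity bound -/

namespace BolzaProblem

open Bolza

variable {T : ℝ} {n m k : ℕ} {P : BolzaProblem n m k}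

/-- The constants of the linear approximation depend on the base point only through a bound. -/
theorem exists_linearApprox (hT : 0 < T) (hP : P.IsC2 T) (M : ℝ) :
    ∃ C, 0 ≤ C ∧ ∀ η > 0, ∃ δ > 0, ∀ z : PD T n m k, z.BoundedBy M → P.Einf z ≠ ∞ →
      P.LinearApprox z C η δ (P.Einf z).toReal := by
  -- The boundary map is treated as a time-dependent one that does not depend on time.
  have hb : ContDiffOn ℝ 1 (fun y : ℝ × E n × E n × E n × E n × E k => P.bdry y.2)
      (Icc 0 T ×ˢ univ) := ((contDiff_bdry hP).comp contDiff_snd).contDiffOn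
  have hf := contDiffOn_field hT hP
  have h0 : (0 : ℝ) ∈ Icc 0 T := ⟨le_rfl, hT.le⟩
  obtain ⟨C₁, hC₁⟩ := exists_bound_fderiv_slice hT hf M
  obtain ⟨C₂, hC₂⟩ := exists_bound_fderiv_slice hT hb M
  refine ⟨max (max C₁ C₂) 0, le_max_right _ _, fun η hη => ?_⟩
  obtain ⟨δ₁, hδ₁, h₁⟩ := exists_uniform_strict_deriv hT hf M hη
  obtain ⟨δ₂, hδ₂, h₂⟩ := exists_uniform_strict_deriv hT hb M hη
  refine ⟨min δ₁ δ₂, lt_min hδ₁ hδ₂, fun z hz hE => ?_⟩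
  have htr := ae_norm_tr_le_of_boundedBy hz
  have hbd := norm_bd_le_of_boundedBy hT hz
  refine ⟨?_, ?_, ?_, ?_, ?_, (ae_norm_res_le hE).1, (ae_norm_res_le hE).2⟩
  · filter_upwards [htr, ae_restrict_mem measurableSet_Icc] with t h1 ht
    exact (hC₁ t ht _ h1).trans ((le_max_left _ _).trans (le_max_left _ _))
  · exact (hC₂ 0 h0 _ hbd).trans ((le_max_right _ _).trans (le_max_left _ _))
  · filter_upwards [htr, ae_restrict_mem measurableSet_Icc] with t h1 ht q q' hq hq'
    exact (h₁ t ht _ q h1 (hq.trans (min_le_left _ _))).2 q' (hq'.trans (min_le_left _ _))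
  · intro y y' hy hy'
    exact (h₂ 0 h0 _ y hbd (hy.trans (min_le_right _ _))).2 y' (hy'.trans (min_le_right _ _))
  · intro y hy
    exact (h₂ 0 h0 _ y hbd (hy.trans (min_le_right _ _))).1

theorem normHux_nonneg (z : PD T n m k) : 0 ≤ P.normHux z := ENNReal.toReal_nonneg

theorem normHup_nonneg (z : PD T n m k) : 0 ≤ P.normHup z := ENNReal.toReal_nonneg

theorem normHux_le (hT : 0 < T) (hP : P.IsC2 T) {z : PD T n m k} {C : ℝ} (hC0 : 0 ≤ C)
    (hC : ∀ᵐ t ∂(timeMeasure T), ‖P.fieldDeriv z t‖ ≤ C) : P.normHux z ≤ C :=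
  toReal_essSup_le hC0 (ae_norm_Hux_le hT hP hC)

theorem normHup_le (hT : 0 < T) (hP : P.IsC2 T) {z : PD T n m k} {C : ℝ} (hC0 : 0 ≤ C)
    (hC : ∀ᵐ t ∂(timeMeasure T), ‖P.fieldDeriv z t‖ ≤ C) : P.normHup z ≤ C :=
  toReal_essSup_le hC0 (ae_norm_Hup_le hT hP hC)

theorem mul_Cgeo_le_Cxp (hT : 0 < T) {c₀ : ℝ} (hc : 0 ≤ c₀) (z : PD T n m k) :
    c₀ * P.Cgeo z * (1 + T) ≤ P.Cxp c₀ z := by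
  have h1 : 0 ≤ P.normA z := ENNReal.toReal_nonneg
  have h2 : 0 ≤ P.normB z := ENNReal.toReal_nonneg
  have h3 := Cgeo_nonneg (P := P) z
  exact le_mul_of_one_le_right (by positivity) (Real.one_le_exp (by positivity))

/-- An upper bound for `C_close` in terms of bounds for `C_geo` and for the derivatives. -/
theorem Cclose_le (hT : 0 < T) (hP : P.IsC2 T) {z : PD T n m k} {C G c₀ ρ : ℝ} (hC0 : 0 ≤ C)
    (hc : 0 ≤ c₀) (hρ : 0 < ρ) (hC : ∀ᵐ t ∂(timeMeasure T), ‖P.fieldDeriv z t‖ ≤ C)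
    (hG : P.Cgeo z ≤ G) {X : ℝ} (hX : X = c₀ * G * (1 + T) * Real.exp ((C + C) * T)) :
    P.Cclose c₀ ρ z ≤ X + (ρ⁻¹ * (C + C) * X + ρ⁻¹) := by
  have h1 : P.normA z ≤ C := toReal_essSup_le hC0 (ae_norm_fx_le hT hP hC)
  have h2 : P.normB z ≤ C := toReal_essSup_le hC0 (ae_norm_fu_le hT hP hC)
  have h3 := normHux_le hT hP hC0 hC
  have h4 := normHup_le hT hP hC0 hC
  have h5 := normHux_nonneg (P := P) z
  have h6 := normHup_nonneg (P := P) z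
  have h7 := Cgeo_nonneg (P := P) z
  have hG0 : 0 ≤ G := h7.trans hG
  have hXp : P.Cxp c₀ z ≤ X := by
    rw [hX, Cxp]
    gcongr
  have hX0 : 0 ≤ P.Cxp c₀ z := by unfold Cxp; positivity
  unfold Cclose Cu
  gcongr

theorem one_add_sqrt_sq_le (hT : 0 < T) : (1 + Real.sqrt T) ^ 2 ≤ 2 * (1 + T) := by
  have := Real.sq_sqrt hT.le
  nlinarith [sq_nonneg (1 - Real.sqrt T)]

/-- A ball whose radius is a fixed multiple `2κ` of the residual is invariant under the simplified
Newton map, once `η` is small: a step bounds all variables by `κ (e + η τ)`. -/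
theorem LinearApprox.mapsTo_supBall (hT : 0 < T) (hP : P.IsC2 T) {zN : PD T n m k}
    {C η δ e ρ Γ κ τ : ℝ} (h : P.LinearApprox zN C η δ e) (hreg : P.StronglyRegular zN)
    (hL : P.StrengthenedLegendre ρ zN) (hρ : 0 < ρ) (hC0 : 0 ≤ C) (he : 0 ≤ e) (hη : 0 ≤ η)
    (hΓ : P.Cgeo zN ≤ Γ)
    (hκ : κ = 3 * (1 + Real.sqrt T) ^ 2 * Γ
      + ρ⁻¹ * (1 + (C + C) * (3 * (1 + Real.sqrt T) ^ 2 * Γ)))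
    (hηκ : η * κ ≤ 1 / 2) (hτ : τ = 2 * κ * e) (hτδ : τ ≤ δ) {z w : PD T n m k}
    (hz : z ∈ zN.supBall τ) (hw : P.IsNewtonStep zN z w) : w ∈ zN.supBall τ := by
  have hΓ0 : 0 ≤ Γ := (Cgeo_nonneg zN).trans hΓ
  have hκ0 : 0 ≤ κ := by rw [hκ]; positivity
  have hτ0 : 0 ≤ τ := by rw [hτ]; positivity
  have ha0 : 0 ≤ e + η * τ := by positivity
  have haτ : κ * (e + η * τ) ≤ τ := by
    have h1 : (η * κ) * (κ * e) ≤ 1 / 2 * (κ * e) := by gcongr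
    rw [hτ]
    linarith
  obtain ⟨b1, b2, b3, b4⟩ := h.step_bounds hT hP hreg hL he hη hτ0 hτδ hz hw rfl
  generalize e + η * τ = a at *
  generalize hB : 3 * (1 + Real.sqrt T) ^ 2 * P.Cgeo zN * a = B at *
  generalize hB₀ : 3 * (1 + Real.sqrt T) ^ 2 * Γ = B₀ at *
  have hB₀0 : 0 ≤ B₀ := by rw [← hB₀]; positivity
  have hBB : B ≤ B₀ * a := by rw [← hB, ← hB₀]; gcongr
  have hκa : B₀ * a + ρ⁻¹ * (a + (C + C) * (B₀ * a)) = κ * a := by rw [hκ]; ring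
  have hs0 : 0 ≤ ρ⁻¹ * (a + (C + C) * (B₀ * a)) := by positivity
  have hs1 : 0 ≤ B₀ * a := by positivity
  have hBτ : B ≤ τ := by linarith
  refine ⟨fun t ht => (b1 t ht).trans hBτ, ?_, fun t ht => (b3 t ht).trans hBτ, b4.trans hBτ⟩
  have hB0 : 0 ≤ B := (norm_nonneg _).trans b4
  have hhC : (P.normHux zN + P.normHup zN) * B ≤ (C + C) * (B₀ * a) := by
    have h1 := normHux_le hT hP hC0 h.deriv_le
    have h2 := normHup_le hT hP hC0 h.deriv_le
    gcongr
  filter_upwards [b2] with t ht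
  have h2 : ‖w.u t - zN.u t‖ ≤ ρ⁻¹ * (a + (C + C) * (B₀ * a)) :=
    (le_inv_mul_iff₀ hρ).2 (ht.trans (by linarith))
  linarith

/-- The asserted distance bound, for a KKT point in the invariant ball. In the estimates for the
state and the costate there is a fixed factor to spare; in the one for the control, the room for the
nonlinear part of the stationarity residual comes from the lower bound for `C_geo`. -/
theorem LinearApprox.supDist_le (hT : 0 < T) (hP : P.IsC2 T) {zN z : PD T n m k}
    {C η δ e ρ κ τ : ℝ} (h : P.LinearApprox zN C η δ e) (hreg : P.StronglyRegular zN)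
    (hL : P.StrengthenedLegendre ρ zN) (hρ : 0 < ρ) (hC0 : 0 ≤ C) (he : 0 ≤ e) (hη : 0 ≤ η)
    (hκ0 : 0 ≤ κ) (hηκ : η * κ ≤ 1 / 2) (hηC : ρ⁻¹ * (η * κ) * (3 * C) ≤ 1)
    (hτ : τ = 2 * κ * e) (hτδ : τ ≤ δ)
    (hz : z ∈ zN.supBall τ) (hkkt : P.IsKKT z) :
    z.supDist zN ≤ ENNReal.ofReal (P.Cclose 32 ρ zN * e) := by
  have hτ0 : 0 ≤ τ := by rw [hτ]; positivity
  obtain ⟨b1, b2, b3, b4⟩ := h.step_bounds hT hP hreg hL he hη hτ0 hτδ hz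
    ((isNewtonStep_self_iff zN z).2 hkkt) rfl
  have hXp := mul_Cgeo_le_Cxp (P := P) hT (c₀ := 32) (by norm_num) zN
  have hlow := hreg.norm_le_Cgeo_mul hT hP h.deriv_le hC0
  have hs2 := one_add_sqrt_sq_le hT
  have h8 : P.Cclose 32 ρ zN * e = P.Cxp 32 zN * e
      + ρ⁻¹ * (P.normHux zN + P.normHup zN) * (P.Cxp 32 zN * e) + ρ⁻¹ * e := by
    rw [Cclose, Cu]; ring
  have hh0 : 0 ≤ P.normHux zN + P.normHup zN :=
    add_nonneg (normHux_nonneg zN) (normHup_nonneg zN)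
  have hg0 : 0 ≤ P.Cgeo zN := Cgeo_nonneg zN
  rw [h8]
  generalize P.normHux zN + P.normHup zN = hh at *
  generalize P.Cgeo zN = g at *
  generalize P.Cxp 32 zN = X at *
  generalize hB : 3 * (1 + Real.sqrt T) ^ 2 * g * (e + η * τ) = B at *
  have hB0 : 0 ≤ B := (norm_nonneg _).trans b4
  have ha2 : e + η * τ ≤ 2 * e := by
    have h1 : (η * κ) * e ≤ 1 / 2 * e := by gcongr
    rw [hτ]
    linarith
  have hge : 0 ≤ g * e := by positivity
  have hgT : g * e ≤ g * (1 + T) * e := by nlinarith [mul_nonneg hge hT.le]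
  have hB2 : B ≤ 12 * (g * (1 + T) * e) := by
    have h1 : (1 + Real.sqrt T) ^ 2 * (g * (e + η * τ)) ≤ 2 * (1 + T) * (g * (2 * e)) := by gcongr
    rw [← hB]
    linarith
  have hXe : 32 * (g * (1 + T) * e) ≤ X * e := by
    have : 32 * g * (1 + T) * e ≤ X * e := by gcongr
    linarith
  have hu : ∀ᵐ t ∂(timeMeasure T),
      ‖z.u t - zN.u t‖ ≤ ρ⁻¹ * e + ρ⁻¹ * hh * B + 2 * (g * e) := by
    filter_upwards [b2] with t ht
    rcases (norm_nonneg (z.u t - zN.u t)).eq_or_lt with h0 | h0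
    · rw [← h0]; positivity
    -- The controls differ at `t`, so there are controls, and `C_geo` is bounded below.
    · have h1 : 1 ≤ 3 * C * g := le_of_mul_le_mul_right (by rw [one_mul]; exact hlow _) h0
      have h2 : ρ⁻¹ * (η * κ) ≤ g := by
        calc ρ⁻¹ * (η * κ) ≤ ρ⁻¹ * (η * κ) * (3 * C * g) :=
              le_mul_of_one_le_right (by positivity) h1
          _ = ρ⁻¹ * (η * κ) * (3 * C) * g := by ring
          _ ≤ 1 * g := by gcongr
          _ = g := one_mul g
      have h3 : ρ⁻¹ * (η * κ) * e ≤ g * e := by gcongr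
      have h4 := (le_inv_mul_iff₀ hρ).2 ht
      have h5 : ρ⁻¹ * (e + η * τ + hh * B)
          = ρ⁻¹ * e + ρ⁻¹ * hh * B + 2 * (ρ⁻¹ * (η * κ) * e) := by rw [hτ]; ring
      rw [h5] at h4
      linarith
  refine (PD.supDist_le hB0 (by positivity) b1 hu b3).trans (ENNReal.ofReal_le_ofReal ?_)
  have h6 : ρ⁻¹ * hh * B ≤ ρ⁻¹ * hh * (X * e) := by
    have h7 : B ≤ X * e := by linarith
    gcongr
  linarith

/-- A KKT point whose state, control and costate are close to those of `zN` lies in a uniform ball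
that controls its multiplier as well. -/
theorem LinearApprox.mem_supBall_of_supDist_le (hT : 0 < T) (hP : P.IsC2 T) {zN z : PD T n m k}
    {C η δ δ' e Γ : ℝ} (h : P.LinearApprox zN C η δ e) (hreg : P.StronglyRegular zN)
    (hC0 : 0 ≤ C) (he : 0 ≤ e) (hη : 0 ≤ η) (hη1 : η ≤ 1) (hδ'0 : 0 ≤ δ') (hδ' : δ' ≤ δ)
    (hΓ : P.Cgeo zN ≤ Γ) (hηΓ : 3 * Γ * η ≤ 1 / 2)
    (hsmall : 6 * Γ * (e + (C + 1) * δ') ≤ δ) (hkkt : P.IsKKT z)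
    (hz : z.supDist zN ≤ ENNReal.ofReal δ') : z ∈ zN.supBall δ := by
  obtain ⟨b1, b2, b3⟩ := PD.bounds_of_supDist_le hδ'0 hz
  refine ⟨fun t ht => (b1 t ht).trans hδ', b2.mono fun t ht => ht.trans hδ',
    fun t ht => (b3 t ht).trans hδ', ?_⟩
  have h1 := h.norm_lam_sub_le hT hP hreg hδ'0 hδ' hη hkkt b1 b3
  have hμ0 : 0 ≤ ‖z.lam - zN.lam‖ := norm_nonneg _
  generalize ‖z.lam - zN.lam‖ = μ at *
  have hΓ0 : 0 ≤ Γ := (Cgeo_nonneg zN).trans hΓ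
  have h2 : μ ≤ 3 * Γ * (e + (C + 1) * δ' + η * μ) := h1.trans (by gcongr)
  have h3 : 3 * Γ * η * μ ≤ 1 / 2 * μ := by gcongr
  linarith

/-- A linearization accuracy `η` that meets all smallness requirements at once, those of the
invariant ball, the contraction, the control estimate and the multiplier estimate. -/
theorem exists_accuracy {Γ κ c r s : ℝ} (hΓ : 0 ≤ Γ) (hκ : 0 ≤ κ) (hc : 0 ≤ c) (hr : 0 ≤ r)
    (hs : 1 ≤ s) :
    ∃ η > 0, η ≤ 1 ∧ η * κ ≤ 1 / 2 ∧ Γ * (9 * s ^ 2 * η) ≤ 1 / 2 ∧ r * (η * κ) * (3 * c) ≤ 1 ∧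
      3 * Γ * η ≤ 1 / 2 := by
  have hQ0 : 0 < 2 * κ + 18 * (s ^ 2 * Γ) + 3 * (c * κ * r) + 1 := by positivity
  obtain ⟨η, hη⟩ : ∃ η, η = (2 * κ + 18 * (s ^ 2 * Γ) + 3 * (c * κ * r) + 1)⁻¹ := ⟨_, rfl⟩
  have hη0 : 0 < η := by rw [hη]; exact inv_pos.2 hQ0
  have hηQ : η * (2 * κ + 18 * (s ^ 2 * Γ) + 3 * (c * κ * r) + 1) = 1 := by
    rw [hη]; exact inv_mul_cancel₀ hQ0.ne'
  have q1 : 0 ≤ η * κ := by positivity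
  have q2 : 0 ≤ η * (s ^ 2 * Γ) := by positivity
  have q3 : 0 ≤ η * (c * κ * r) := by positivity
  have q4 : η * Γ ≤ η * (s ^ 2 * Γ) := by
    gcongr; exact le_mul_of_one_le_left hΓ (one_le_pow₀ hs)
  refine ⟨η, hη0, ?_, ?_, ?_, ?_, ?_⟩ <;> linarith

end BolzaProblem

theorem mainTheorem2 :
    ∃ c₀ : ℝ, 0 < c₀ ∧
      ∀ (n m k : ℕ) (T : ℝ) (_ : 0 < T) (P : BolzaProblem n m k) (_ : P.IsC2 T)
        (ρ M G : ℝ) (_ : 0 < ρ),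
        ∃ ε δ : ℝ, 0 < ε ∧ 0 < δ ∧
          ∀ zN : Bolza.PD T n m k,
            zN.BoundedBy M →
            P.StrengthenedLegendre ρ zN →
            P.StronglyRegular zN →
            P.Cgeo zN ≤ G →
            P.Einf zN ≤ ENNReal.ofReal ε →
            ENNReal.ofReal (P.Cclose c₀ ρ zN) * P.Einf zN ≤ ENNReal.ofReal δ ∧
            ∃ zs : Bolza.PD T n m k,
              P.IsKKT zs ∧
              zs.supDist zN ≤ ENNReal.ofReal (P.Cclose c₀ ρ zN) * P.Einf zN ∧
              ∀ z : Bolza.PD T n m k,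
                P.IsKKT z → z.supDist zN ≤ ENNReal.ofReal δ → z = zs := by
  refine ⟨32, by norm_num, fun n m k T hT P hP ρ M G hρ => ?_⟩
  obtain ⟨C, hC0, happrox⟩ := BolzaProblem.exists_linearApprox hT hP M
  obtain ⟨Γ, hGΓ, hΓ0⟩ : ∃ Γ, G ≤ Γ ∧ 0 ≤ Γ := ⟨max G 0, le_max_left _ _, le_max_right _ _⟩
  -- A residual of size `a` moves all variables by at most `κ * a`.
  obtain ⟨κ, hκ⟩ : ∃ κ, κ = 3 * (1 + Real.sqrt T) ^ 2 * Γ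
      + ρ⁻¹ * (1 + (C + C) * (3 * (1 + Real.sqrt T) ^ 2 * Γ)) := ⟨_, rfl⟩
  have hκ0 : 0 < κ := by rw [hκ]; positivity
  obtain ⟨η, hη0, hη1, hηκ, hηc, hηC, hηΓ⟩ := BolzaProblem.exists_accuracy hΓ0 hκ0.le hC0
    (inv_pos.2 hρ).le (le_add_of_nonneg_right (Real.sqrt_nonneg T))
  obtain ⟨δ', hδ', happ⟩ := happrox η hη0
  -- `δ` is smaller than the radius `δ'` of validity of the linear approximation so that the
  -- multipliers of the KKT points at distance `δ` stay within `δ'`.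
  obtain ⟨δ, hδ⟩ : ∃ δ, δ = δ' / (12 * Γ * (C + 1) + 1) := ⟨_, rfl⟩
  have hδ0 : 0 < δ := by rw [hδ]; positivity
  have hδδ : δ * (12 * Γ * (C + 1) + 1) = δ' := by
    rw [hδ]; exact div_mul_cancel₀ _ (by positivity)
  have hδle : δ ≤ δ' := by
    have : 0 ≤ δ * (12 * Γ * (C + 1)) := by positivity
    linarith
  -- `Kc` bounds `C_close` uniformly, so that `ε ≤ δ / Kc` gives `C_close * E_∞ ≤ δ`.
  obtain ⟨X, hX⟩ : ∃ X, X = 32 * Γ * (1 + T) * Real.exp ((C + C) * T) := ⟨_, rfl⟩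
  have hX0 : 0 ≤ X := by rw [hX]; positivity
  obtain ⟨Kc, hKc⟩ : ∃ Kc, Kc = X + (ρ⁻¹ * (C + C) * X + ρ⁻¹) := ⟨_, rfl⟩
  have hKc0 : 0 < Kc := by rw [hKc]; positivity
  obtain ⟨ε, hε0, hε1, hε2⟩ : ∃ ε > 0, ε * (12 * Γ + 2 * κ) ≤ δ' ∧ ε * Kc ≤ δ :=
    ⟨min (δ' / (12 * Γ + 2 * κ)) (δ / Kc), lt_min (by positivity) (by positivity),
      (le_div_iff₀ (by positivity)).1 (min_le_left _ _),
      (le_div_iff₀ (by positivity)).1 (min_le_right _ _)⟩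
  refine ⟨ε, δ, hε0, hδ0, fun zN hM hL hreg hG hE => ?_⟩
  have hEtop : P.Einf zN ≠ ∞ := ne_top_of_le_ne_top ENNReal.ofReal_ne_top hE
  have h := happ zN hM hEtop
  have he0 : 0 ≤ (P.Einf zN).toReal := ENNReal.toReal_nonneg
  have heε : (P.Einf zN).toReal ≤ ε := ENNReal.toReal_le_of_le_ofReal hε0.le hE
  have hEe : P.Einf zN = ENNReal.ofReal (P.Einf zN).toReal := (ENNReal.ofReal_toReal hEtop).symm
  generalize (P.Einf zN).toReal = e at *
  have hgΓ : P.Cgeo zN ≤ Γ := hG.trans hGΓ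
  have hcon : P.Cgeo zN * (9 * (1 + Real.sqrt T) ^ 2 * η) ≤ 1 / 2 :=
    le_trans (mul_le_mul_of_nonneg_right hgΓ (by positivity)) hηc
  have hclose : P.Cclose 32 ρ zN * e ≤ δ := by
    have h1 : P.Cclose 32 ρ zN ≤ Kc :=
      hKc ▸ BolzaProblem.Cclose_le hT hP hC0 (by norm_num) hρ h.deriv_le hgΓ hX
    have h2 : P.Cclose 32 ρ zN * e ≤ Kc * ε := by gcongr
    linarith
  have heΓ : e * Γ ≤ ε * Γ := by gcongr
  have heκ : e * κ ≤ ε * κ := by gcongr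
  have hεΓ0 : 0 ≤ ε * Γ := by positivity
  have hεκ0 : 0 ≤ ε * κ := by positivity
  have hτ0 : 0 ≤ 2 * κ * e := by positivity
  have hτδ : 2 * κ * e ≤ δ' := by linarith
  rw [hEe, ← ENNReal.ofReal_mul' he0]
  obtain ⟨zs, hzs, hkkt⟩ := h.exists_isKKT hT hP hreg hη0.le hτ0 hτδ
    (fun z hz w hw => h.mapsTo_supBall hT hP hreg hL hρ hC0 he0 hη0.le hgΓ hκ hηκ rfl hτδ hz hw)
    hcon
  refine ⟨ENNReal.ofReal_le_ofReal hclose, zs, hkkt,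
    h.supDist_le hT hP hreg hL hρ hC0 he0 hη0.le hκ0.le hηκ hηC rfl hτδ hzs hkkt,
    fun z hz hdist => ?_⟩
  have hsmall : 6 * Γ * (e + (C + 1) * δ) ≤ δ' := by linarith
  exact h.eq_of_isKKT hT hP hreg hη0.le hcon
    (h.mem_supBall_of_supDist_le hT hP hreg hC0 he0 hη0.le hη1 hδ0.le hδle hgΓ hηΓ hsmall hz hdist)
    (zN.supBall_mono hτδ hzs) hz hkkt
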